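/- Let $\mathcal H$ be a finite-dimensional complex Hilbert space and let $\rho_1,\dots,\rho_K$ be density operators on $\mathcal H$ such that $\frac1K\sum_k\rho_k$ has support $\mathcal H$. A quantum operation is a completely positive, trace-preserving linear map. Then there is an orthogonal decomposition $\mathcal H=\bigoplus_j \mathcal J_j\otimes\mathcal K_j$ into a direct sum of tensor products of nonzero spaces, and there are states $\omega_j$ on $\mathcal K_j$, such that the following hold. 1. For every $k$, $\rho_k=\bigoplus_j q_{j|k}\,\rho_{j|k}\otimes\omega_j$, where $(q_{j|k})_j$ is a probability distribution and each $\rho_{j|k}$ is a state on $\mathcal J_j$; the states $\omega_j$ do not depend on $k$. 2. Let $T:\mathcal B(\mathcal H)\to\mathcal B(\mathcal H)$ be a quantum operation with $T\rho_k=\rho_k$ for all $k$, and let $T\sigma=\operatorname{Tr}_{\mathcal E}\bigl(U(\sigma\otimes\varepsilon)U^*\bigr)$ be any representation of $T$ with a finite-dimensional Hilbert space $\mathcal E$, a state $\varepsilon$ on $\mathcal E$ and a unitary $U$ on $\mathcal H\otimes\mathcal E$. Then there are unitaries $U_j$ on $\mathcal K_j\otimes\mathcal E$ with $\operatorname{Tr}_{\mathcal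 E}\bigl(U_j(\omega_j\otimes\varepsilon)U_j^*\bigr)=\omega_j$ for all $j$, such that $U=\bigoplus_j 1_{\mathcal J_j}\otimes U_j$ on the subspace $\mathcal H\otimes\operatorname{supp}\varepsilon$. In particular, $U=\bigoplus_j 1_{\mathcal J_j}\otimes U_j$ on all of $\mathcal H\otimes\mathcal E$ if $\varepsilon$ has full support. 2'. For every quantum operation $T$ with $T\rho_k=\rho_k$ for all $k$ there are quantum operations $T_j$ on $\mathcal B(\mathcal K_j)$ with $T_j(\omega_j)=\omega_j$ and $T|_{\mathcal B(\mathcal J_j\otimes\mathcal K_j)}=\mathrm{id}\otimes T_j$ for all $j$. Moreover, for every such decomposition of $\mathcal H$ with states $\omega_j$ for which 1 holds, and for every quantum operation $T$ fixing all $\rho_k$, the property in 2' holds for $T$ if and only if the property in 2 holds for all representations $(\mathcal E,\varepsilon,U)$ of $T$. -/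

import Mathlib

open Matrix
open scoped Kronecker ComplexOrder

/-- A density operator on `ℂⁿ` (every finite-dimensional Hilbert space, in an orthonormal basis). -/
structure IsDensity {n : Type*} [Fintype n] (ρ : Matrix n n ℂ) : Prop where
  posSemidef : ρ.PosSemidef
  trace_eq_one : ρ.trace = 1

open scoped Matrix.Norms.L2Operator MatrixOrder in
/-- A quantum operation on `B(ℂⁿ)`: a completely positive, trace-preserving linear map.  Complete
positivity is Mathlib's, for the C⋆-algebra of matrices with operator norm and Loewner order. -/
structure IsQuantumOperation {n : Type*} [Fintype n] [DecidableEq n]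
    (T : Matrix n n ℂ →ₗ[ℂ] Matrix n n ℂ) : Prop where
  completelyPositive :
    ∃ Φ : CompletelyPositiveMap (Matrix n n ℂ) (Matrix n n ℂ), Φ.toLinearMap = T
  trace_map : ∀ σ, (T σ).trace = σ.trace

/-- The partial trace over the second tensor factor, `Tr_E : B(H ⊗ E) → B(H)`. -/
def traceEnv {n e : Type*} [Fintype e] (M : Matrix (n × e) (n × e) ℂ) : Matrix n n ℂ :=
  Matrix.of fun i j => ∑ a, M (i, a) (j, a)

/-- `T σ = Tr_E (U (σ ⊗ ε) U*)`, with `ε` a state on `E` and `U` a unitary on `H ⊗ E`. -/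
structure IsStinespring {n e : Type*} [Fintype n] [DecidableEq n] [Fintype e] [DecidableEq e]
    (T : Matrix n n ℂ →ₗ[ℂ] Matrix n n ℂ) (ε : Matrix e e ℂ)
    (U : Matrix (n × e) (n × e) ℂ) : Prop where
  isDensity : IsDensity ε
  unitary : U ∈ unitaryGroup (n × e) ℂ
  map_eq : ∀ σ, T σ = traceEnv (U * (σ ⊗ₖ ε) * Uᴴ)

/-- An orthogonal decomposition `H = ⨁ⱼ Jⱼ ⊗ Kⱼ` of `H = ℂⁿ` with nonzero `Jⱼ`, `Kⱼ`, given by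
the unitary `W : ⨁ⱼ ℂ^{dJ j} ⊗ ℂ^{dK j} → H` whose columns are the images of the product basis. -/
structure TensorDecomposition (n : Type*) [Fintype n] [DecidableEq n] where
  m : ℕ
  dJ : Fin m → ℕ
  dK : Fin m → ℕ
  dJ_pos : ∀ j, 0 < dJ j
  dK_pos : ∀ j, 0 < dK j
  W : Matrix n (Σ j, Fin (dJ j) × Fin (dK j)) ℂ
  conjTranspose_mul_self : Wᴴ * W = 1
  mul_conjTranspose_self : W * Wᴴ = 1

namespace TensorDecomposition

variable {n : Type*} [Fintype n] [DecidableEq n] (D : TensorDecomposition n)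

/-- Operators on `Jⱼ`. -/
abbrev OpJ (j : Fin D.m) : Type := Matrix (Fin (D.dJ j)) (Fin (D.dJ j)) ℂ

/-- Operators on `Kⱼ`. -/
abbrev OpK (j : Fin D.m) : Type := Matrix (Fin (D.dK j)) (Fin (D.dK j)) ℂ

/-- Operators on `Kⱼ ⊗ E`. -/
abbrev OpKE (e : Type*) (j : Fin D.m) : Type _ :=
  Matrix (Fin (D.dK j) × e) (Fin (D.dK j) × e) ℂ

/-- The operator `⨁ⱼ Xⱼ` on `H`, for operators `Xⱼ` on `Jⱼ ⊗ Kⱼ`. -/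
def directSum (X : ∀ j, Matrix (Fin (D.dJ j) × Fin (D.dK j)) (Fin (D.dJ j) × Fin (D.dK j)) ℂ) :
    Matrix n n ℂ :=
  D.W * blockDiagonal' X * D.Wᴴ

/-- The isometric embedding of `Jⱼ ⊗ Kⱼ` into `H`. -/
def incl (j : Fin D.m) : Matrix n (Fin (D.dJ j) × Fin (D.dK j)) ℂ :=
  D.W.submatrix id fun x => ⟨j, x⟩

/-- An operator on the block `Jⱼ ⊗ Kⱼ` as an operator on `H`, zero on the other blocks. -/
def embed (j : Fin D.m)
    (X : Matrix (Fin (D.dJ j) × Fin (D.dK j)) (Fin (D.dJ j) × Fin (D.dK j)) ℂ) : Matrix n n ℂ :=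
  D.incl j * X * (D.incl j)ᴴ

/-- The operator `⨁ⱼ 1_{Jⱼ} ⊗ Vⱼ` on `H ⊗ E = ⨁ⱼ Jⱼ ⊗ (Kⱼ ⊗ E)`, for `Vⱼ` on `Kⱼ ⊗ E`. -/
def directSumEnv {e : Type*} [Fintype e] [DecidableEq e] (V : ∀ j, D.OpKE e j) :
    Matrix (n × e) (n × e) ℂ :=
  (D.W ⊗ₖ (1 : Matrix e e ℂ)) *
    (blockDiagonal' fun j =>
      ((1 : D.OpJ j) ⊗ₖ V j).submatrix (Equiv.prodAssoc _ _ _) (Equiv.prodAssoc _ _ _)).submatrix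
        (Equiv.sigmaProdDistrib _ e) (Equiv.sigmaProdDistrib _ e) *
    (D.W ⊗ₖ (1 : Matrix e e ℂ))ᴴ

/-- `ρ = ⨁ⱼ qⱼ ρⱼ ⊗ ωⱼ` with `q` a probability distribution and `ρⱼ` states on `Jⱼ`. -/
def Decomposes (ω : ∀ j, D.OpK j) (ρ : Matrix n n ℂ) : Prop :=
  ∃ (q : Fin D.m → ℝ) (r : ∀ j, D.OpJ j),
    (∀ j, 0 ≤ q j) ∧ ∑ j, q j = 1 ∧ (∀ j, IsDensity (r j)) ∧
      ρ = D.directSum fun j => (q j : ℂ) • (r j ⊗ₖ ω j)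

/-- `T` restricts on each `B(Jⱼ ⊗ Kⱼ)` to `id ⊗ Tⱼ`, for quantum operations `Tⱼ` on `B(Kⱼ)`
with `Tⱼ ωⱼ = ωⱼ`. -/
def ActsBlockwise (ω : ∀ j, D.OpK j) (T : Matrix n n ℂ →ₗ[ℂ] Matrix n n ℂ) : Prop :=
  ∃ S : ∀ j, D.OpK j →ₗ[ℂ] D.OpK j,
    (∀ j, IsQuantumOperation (S j)) ∧ (∀ j, S j (ω j) = ω j) ∧
      ∀ j (A : D.OpJ j) (B : D.OpK j), T (D.embed j (A ⊗ₖ B)) = D.embed j (A ⊗ₖ S j B)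

/-- `U = ⨁ⱼ 1_{Jⱼ} ⊗ Vⱼ` on `H ⊗ supp ε` (which is the range of `1 ⊗ ε`), hence on all of `H ⊗ E`
if `ε` has full support, with unitaries `Vⱼ` on `Kⱼ ⊗ E` such that
`Tr_E (Vⱼ (ωⱼ ⊗ ε) Vⱼ*) = ωⱼ`. -/
def HasBlockForm {e : Type*} [Fintype e] [DecidableEq e] (ω : ∀ j, D.OpK j)
    (ε : Matrix e e ℂ) (U : Matrix (n × e) (n × e) ℂ) : Prop :=
  ∃ V : ∀ j, D.OpKE e j,
    (∀ j, V j ∈ unitaryGroup (Fin (D.dK j) × e) ℂ) ∧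
    (∀ j, traceEnv (V j * (ω j ⊗ₖ ε) * (V j)ᴴ) = ω j) ∧
    U * ((1 : Matrix n n ℂ) ⊗ₖ ε) = D.directSumEnv V * ((1 : Matrix n n ℂ) ⊗ₖ ε) ∧
    (ε.PosDef → U = D.directSumEnv V)

end TensorDecomposition

/-! Everything is expressed through Kraus operators. Call an operation invariant if it fixes all `ρ
k`. The average `R` of the states is faithful, so the fixed points of the dual `T*` of an invariant
`T` are exactly the matrices commuting with the Kraus operators `M i` of `T` and their adjoints: for
such a fixed point `X`, the sum of the squares `|[X, M i]|²` equals `T*(X*X) - X*X`, whose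
expectation in `R` vanishes (`commute_kraus_of_fixed`). Averaging two invariant operations
intersects these commutants. Hence the commutant `A` of least dimension, attained by some `T₀`,
commutes with the Kraus operators of every invariant operation (`exists_krausCommutant_le`). A limit
point `P` of the Cesàro means of `T₀` is invariant and satisfies `P T₀ = P`, so the dual of `P` maps
into `A` (`exists_conditional_expectation`).

Splitting `H` into irreducible subspaces for `A` and grouping equivalent ones gives `⨁ⱼ Jⱼ ⊗ Kⱼ`
with `A` inside `⨁ⱼ B(Jⱼ) ⊗ 1` and its commutant inside `⨁ⱼ 1 ⊗ B(Kⱼ)`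
(`exists_tensorDecomposition`). All invariant operations therefore have Kraus operators `⨁ⱼ 1 ⊗ Nⱼ`,
which gives 2'. As the dual of `P` lands in `⨁ⱼ B(Jⱼ) ⊗ 1`, the operation `P` erases the coherences
between blocks and replaces the state on each `Kⱼ` by a fixed `ωⱼ`; reading this off from `ρ k = P
(ρ k)` gives 1 (`eq_directSum_of_krausMap_eq`).

For the equivalence of 2 and 2', write `ε = C C*`. The slices of `U (1 ⊗ C)` over the environment
are Kraus operators of `T` (`traceEnv_eq_krausMap`). Blockwise action forces them to be `⨁ⱼ 1 ⊗ Nⱼ`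
(`exists_kraus_eq_directSum`), and a comparison of Gram matrices produces the unitaries on `Kⱼ ⊗ E`.
Conversely, a single representation with pure `ε` already determines the Kraus operators. -/

/-! ### Kraus operators and complete positivity. -/

/-- The map `σ ↦ ∑ᵢ Mᵢ σ Mᵢ*` with Kraus operators `Mᵢ`. -/
def krausMap {ι n : Type*} [Fintype ι] [Fintype n] (M : ι → Matrix n n ℂ) :
    Matrix n n ℂ →ₗ[ℂ] Matrix n n ℂ where
  toFun σ := ∑ i, M i * σ * (M i)ᴴ
  map_add' σ τ := by simp [mul_add, add_mul, Finset.sum_add_distrib]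
  map_smul' c σ := by simp [Finset.smul_sum]

lemma krausMap_apply {ι n : Type*} [Fintype ι] [Fintype n] (M : ι → Matrix n n ℂ)
    (σ : Matrix n n ℂ) : krausMap M σ = ∑ i, M i * σ * (M i)ᴴ := rfl

lemma trace_krausMap_mul {ι n : Type*} [Fintype ι] [Fintype n] (M : ι → Matrix n n ℂ)
    (σ X : Matrix n n ℂ) :
    (krausMap M σ * X).trace = (σ * ∑ i, (M i)ᴴ * X * M i).trace := by
  simp only [krausMap_apply, Finset.sum_mul, Finset.mul_sum, trace_sum]
  refine Finset.sum_congr rfl fun i _ => ?_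
  rw [Matrix.mul_assoc, Matrix.mul_assoc, trace_mul_comm]
  simp only [Matrix.mul_assoc]

lemma eq_of_forall_trace_mul_eq {n : Type*} [Fintype n] {X Y : Matrix n n ℂ}
    (h : ∀ σ : Matrix n n ℂ, (σ * X).trace = (σ * Y).trace) : X = Y := by
  classical
  ext i j
  have := h (Matrix.single j i 1)
  simpa [Matrix.trace_single_mul] using this

lemma PosSemidef.exists_eq_conjTranspose_mul_self {n : Type*} [Fintype n]
    {A : Matrix n n ℂ} (hA : A.PosSemidef) : ∃ B : Matrix n n ℂ, A = Bᴴ * B := by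
  classical
  open scoped Matrix.Norms.L2Operator MatrixOrder in
  exact CStarAlgebra.nonneg_iff_eq_star_mul_self.mp hA.nonneg

lemma NonUnitalCStarAlgebra.exists_eq_star_mul_self {A : Type*} [NonUnitalCStarAlgebra A]
    [PartialOrder A] [StarOrderedRing A] {a : A} (ha : 0 ≤ a) : ∃ b, a = star b * b :=
  CStarAlgebra.nonneg_iff_eq_star_mul_self.mp ha

open scoped CStarAlgebra in
lemma CStarMatrix.exists_eq_star_mul_self {k A : Type*} [Fintype k] [NonUnitalCStarAlgebra A]
    [PartialOrder A] [StarOrderedRing A] {M : CStarMatrix k k A} (hM : 0 ≤ M) :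
    ∃ B : CStarMatrix k k A, M = star B * B :=
  NonUnitalCStarAlgebra.exists_eq_star_mul_self hM

open scoped Matrix.Norms.L2Operator MatrixOrder in
/-- A map with Kraus operators is completely positive. -/
lemma krausMap_completelyPositive {ι n : Type*} [Fintype ι] [Fintype n] [DecidableEq n]
    (M : ι → Matrix n n ℂ) :
    ∃ Φ : CompletelyPositiveMap (Matrix n n ℂ) (Matrix n n ℂ), Φ.toLinearMap = krausMap M := by
  refine ⟨⟨krausMap M, fun k A hA => ?_⟩, rfl⟩
  obtain ⟨B, rfl⟩ := CStarMatrix.exists_eq_star_mul_self hA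
  have : (star B * B).map (krausMap M) = ∑ i,
      star (B.map fun X => X * (M i)ᴴ) * (B.map fun X => X * (M i)ᴴ) := by
    refine CStarMatrix.ext fun p q => ?_
    have hs : ∀ (f : ι → CStarMatrix (Fin k) (Fin k) (Matrix n n ℂ)),
        (∑ i, f i) p q = ∑ i, f i p q := fun f => by
      exact Matrix.sum_apply p q Finset.univ f
    rw [hs]
    simp only [CStarMatrix.map_apply, CStarMatrix.mul_apply, CStarMatrix.star_apply, krausMap_apply,
      Finset.mul_sum, Finset.sum_mul]
    refine Finset.sum_congr rfl fun i _ => Finset.sum_congr rfl fun j _ => ?_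
    simp [Matrix.star_eq_conjTranspose, Matrix.mul_assoc]
  erw [this]
  exact Finset.sum_nonneg fun i _ => star_mul_self_nonneg _

lemma isQuantumOperation_krausMap {ι n : Type*} [Fintype ι] [Fintype n] [DecidableEq n]
    {M : ι → Matrix n n ℂ} (hM : ∑ i, (M i)ᴴ * M i = 1) : IsQuantumOperation (krausMap M) := by
  refine ⟨krausMap_completelyPositive M, fun σ => ?_⟩
  have := trace_krausMap_mul M σ 1
  simpa [hM] using this

lemma sum_conjTranspose_mul_self_of_trace {ι n : Type*} [Fintype ι] [Fintype n] [DecidableEq n]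
    {M : ι → Matrix n n ℂ} (hM : ∀ σ, (krausMap M σ).trace = σ.trace) :
    ∑ i, (M i)ᴴ * M i = 1 := by
  refine eq_of_forall_trace_mul_eq fun σ => ?_
  have := trace_krausMap_mul M σ 1
  simpa [hM] using this.symm

open scoped Matrix.Norms.L2Operator MatrixOrder in
/-- Choi's theorem. -/
lemma CompletelyPositiveMap.exists_krausMap {n : Type*} [Fintype n] [DecidableEq n]
    (Φ : CompletelyPositiveMap (Matrix n n ℂ) (Matrix n n ℂ)) :
    ∃ M : n × n → Matrix n n ℂ, Φ.toLinearMap = krausMap M := by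
  let E : CStarMatrix n n (Matrix n n ℂ) := CStarMatrix.ofMatrix (fun a b => Matrix.single a b 1)
  have hE : 0 ≤ E := by
    by_cases hn : Nonempty n
    · obtain ⟨a0⟩ := hn
      -- Only row `a0` of `F` is nonzero, so the entries of `F* F` are the products `|a⟩⟨a0|
      -- |a0⟩⟨b|`.
      let F : CStarMatrix n n (Matrix n n ℂ) :=
        CStarMatrix.ofMatrix (fun a b => if a = a0 then Matrix.single a0 b 1 else 0)
      have : E = star F * F := by
        refine CStarMatrix.ext fun a b => ?_
        rw [CStarMatrix.mul_apply]
        change Matrix.single a b (1 : ℂ) = ∑ x,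
          (if x = a0 then Matrix.single a0 a 1 else 0 : Matrix n n ℂ)ᴴ *
            (if x = a0 then Matrix.single a0 b 1 else 0)
        simp [apply_ite Matrix.conjTranspose]
      rw [this]
      exact star_mul_self_nonneg _
    · have : E = 0 := CStarMatrix.ext fun a => (hn ⟨a⟩).elim
      rw [this]
  obtain ⟨B, hB⟩ := CStarMatrix.exists_eq_star_mul_self (Φ.map_cstarMatrix_nonneg E hE)
  have hΦ : ∀ a b, Φ.toLinearMap (Matrix.single a b 1) = ∑ c, (B c a)ᴴ * B c b := fun a b => by
    have := congrFun (congrFun hB a) b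
    rw [CStarMatrix.mul_apply] at this
    exact this
  -- Writing out the inner product `(B c a)ᴴ * B c b` as a sum over a row index `d` splits each
  -- value on a matrix unit into rank-one terms; the pair `(c, d)` labels the Kraus operators.
  refine ⟨fun p => of fun i a => star (B p.1 a p.2 i), ?_⟩
  refine Matrix.ext_linearMap _ fun a b => LinearMap.ext_ring ?_
  ext i j
  simp only [LinearMap.comp_apply, Matrix.singleLinearMap_apply, hΦ, krausMap_apply,
    Matrix.sum_apply, Matrix.mul_apply, Matrix.conjTranspose_apply, Fintype.sum_prod_type]
  refine Finset.sum_congr rfl fun c _ => Finset.sum_congr rfl fun d _ => ?_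
  simp [Matrix.single_apply, ite_and]

lemma IsQuantumOperation.exists_krausMap {n : Type*} [Fintype n] [DecidableEq n]
    {T : Matrix n n ℂ →ₗ[ℂ] Matrix n n ℂ} (hT : IsQuantumOperation T) :
    ∃ M : n × n → Matrix n n ℂ, T = krausMap M ∧ ∑ i, (M i)ᴴ * M i = 1 := by
  obtain ⟨Φ, hΦ⟩ := hT.completelyPositive
  obtain ⟨M, hM⟩ := Φ.exists_krausMap
  refine ⟨M, hΦ.symm.trans hM, sum_conjTranspose_mul_self_of_trace ?_⟩
  rw [← hM, hΦ]
  exact hT.trace_map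

/-! ### Unitaries from Gram matrices, and elementary matrix facts. -/

/-- Square matrices with the same Gram matrix differ by a unitary. -/
lemma exists_unitary_eq_mul {n : Type*} [Fintype n] [DecidableEq n] {A B : Matrix n n ℂ}
    (h : Aᴴ * A = Bᴴ * B) : ∃ V ∈ unitaryGroup n ℂ, A = V * B := by
  let a := toEuclideanLin A
  let b := toEuclideanLin B
  have hnorm : ∀ v, ‖a v‖ = ‖b v‖ := by
    have key : ∀ (C : Matrix n n ℂ) (v : EuclideanSpace ℂ n),
        inner ℂ (toEuclideanLin C v) (toEuclideanLin C v) =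
          inner ℂ v (toEuclideanLin (Cᴴ * C) v) := by
      intro C v
      rw [← LinearMap.adjoint_inner_right, ← Matrix.toEuclideanLin_conjTranspose_eq_adjoint]
      congr 1
      simp [Matrix.toEuclideanLin, Matrix.toLpLin_apply]
    intro v
    have h1 := key A v
    rw [h, ← key B v, inner_self_eq_norm_sq_to_K, inner_self_eq_norm_sq_to_K] at h1
    have h2 : ‖a v‖ ^ 2 = ‖b v‖ ^ 2 := by exact_mod_cast h1
    exact (pow_left_inj₀ (norm_nonneg _) (norm_nonneg _) two_ne_zero).mp h2
  have hker : LinearMap.ker b ≤ LinearMap.ker a := by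
    intro v hv
    rw [LinearMap.mem_ker] at *
    rw [← norm_eq_zero, hnorm, hv, norm_zero]
  -- The assignment `B v ↦ A v` is well defined and isometric on the range of `B` because `‖A v‖ =
  -- ‖B v‖`; it then extends to an isometry of the whole finite-dimensional space.
  let f : LinearMap.range b →ₗ[ℂ] EuclideanSpace ℂ n :=
    (Submodule.liftQ _ a hker).comp (b.quotKerEquivRange.symm : _ →ₗ[ℂ] _)
  have hf : ∀ v, f ⟨b v, v, rfl⟩ = a v := by
    intro v
    have : b.quotKerEquivRange.symm ⟨b v, v, rfl⟩ = Submodule.Quotient.mk v := by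
      rw [LinearEquiv.symm_apply_eq]
      rfl
    simp only [f, LinearMap.comp_apply, LinearEquiv.coe_coe, this]
    simp
  let L : LinearMap.range b →ₗᵢ[ℂ] EuclideanSpace ℂ n := ⟨f, by
    rintro ⟨_, v, rfl⟩
    rw [hf, hnorm]
    rfl⟩
  let g := L.extend
  have hg : ∀ v, g (b v) = a v := fun v => by
    rw [← hf v]
    exact L.extend_apply ⟨b v, v, rfl⟩
  let V := toEuclideanLin.symm g.toLinearMap
  have hV : toEuclideanLin V = g.toLinearMap := by simp [V]
  refine ⟨V, ?_, ?_⟩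
  · rw [mem_unitaryGroup_iff']
    apply toEuclideanLin.injective
    refine LinearMap.ext fun v => ext_inner_left ℂ fun w => ?_
    have : toEuclideanLin (star V * V) v = toEuclideanLin Vᴴ (toEuclideanLin V v) := by
      simp [Matrix.toEuclideanLin, star_eq_conjTranspose]
    rw [this, Matrix.toEuclideanLin_conjTranspose_eq_adjoint, LinearMap.adjoint_inner_right, hV]
    rw [LinearIsometry.coe_toLinearMap, g.inner_map_map]
    simp [Matrix.toEuclideanLin]
  · apply toEuclideanLin.injective
    refine LinearMap.ext fun v => ?_
    have : toEuclideanLin (V * B) v = toEuclideanLin V (toEuclideanLin B v) := by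
      simp [Matrix.toEuclideanLin, Matrix.toLpLin_apply]
    rw [this, hV]
    exact (hg v).symm

/-- With `ι` the Kraus index, this turns a vanishing diagonal entry of an output of the map into
vanishing entries of every single Kraus operator. -/
lemma sum_mul_star_eq_zero {ι : Type*} [Fintype ι] {x : ι → ℂ}
    (h : ∑ i, x i * star (x i) = 0) (i : ι) : x i = 0 := by
  have := (Finset.sum_eq_zero_iff_of_nonneg fun i _ => mul_star_self_nonneg (x i)).mp h i
    (Finset.mem_univ i)
  simpa using this

lemma one_kronecker_injective {m k : Type*} [Nonempty m] [DecidableEq m] {X Y : Matrix k k ℂ}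
    (h : (1 : Matrix m m ℂ) ⊗ₖ X = (1 : Matrix m m ℂ) ⊗ₖ Y) : X = Y := by
  obtain ⟨a⟩ := ‹Nonempty m›
  ext i j
  simpa using congrFun (congrFun h (a, i)) (a, j)

lemma sum_kronecker_right {ι m k : Type*} [Fintype ι] (A : Matrix m m ℂ) (X : ι → Matrix k k ℂ) :
    ∑ i, A ⊗ₖ X i = A ⊗ₖ ∑ i, X i := by
  ext x y
  simp [Matrix.sum_apply, Finset.mul_sum]

/-! ### Slices over the environment. -/

/-- The block `⟨b| M |a⟩` of an operator `M` on `H ⊗ E`. -/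
def envSlice {n e : Type*} (M : Matrix (n × e) (n × e) ℂ) (b a : e) : Matrix n n ℂ :=
  M.submatrix (fun x => (x, b)) (fun x => (x, a))

section envSlice

variable {n e : Type*}

lemma envSlice_apply (M : Matrix (n × e) (n × e) ℂ) (b a : e) (x y : n) :
    envSlice M b a x y = M (x, b) (y, a) := rfl

lemma envSlice_ext {M N : Matrix (n × e) (n × e) ℂ} (h : ∀ b a, envSlice M b a = envSlice N b a) :
    M = N := by
  ext ⟨x, b⟩ ⟨y, a⟩
  exact congrFun (congrFun (h b a) x) y

lemma envSlice_mul [Fintype n] [Fintype e] (M N : Matrix (n × e) (n × e) ℂ) (b a : e) :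
    envSlice (M * N) b a = ∑ c, envSlice M b c * envSlice N c a := by
  ext x y
  simp only [envSlice_apply, Matrix.mul_apply, Matrix.sum_apply, Fintype.sum_prod_type]
  exact Finset.sum_comm

lemma envSlice_conjTranspose (M : Matrix (n × e) (n × e) ℂ) (b a : e) :
    envSlice Mᴴ b a = (envSlice M a b)ᴴ := rfl

lemma envSlice_one_kronecker [DecidableEq n] (C : Matrix e e ℂ) (b a : e) :
    envSlice ((1 : Matrix n n ℂ) ⊗ₖ C) b a = C b a • 1 := by
  ext x y
  simp [envSlice_apply, mul_comm]

/-- A factorization of the environment state puts one factor on each side of `σ ⊗ 1`; expanding the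
partial trace in the basis of `E` then gives a sum of Kraus terms. Thus a representation enters the
map only through `U (1 ⊗ C)`. -/
lemma traceEnv_eq_krausMap [Fintype n] [DecidableEq n] [Fintype e] [DecidableEq e]
    (U : Matrix (n × e) (n × e) ℂ)
    (C : Matrix e e ℂ) (σ : Matrix n n ℂ) :
    traceEnv (U * (σ ⊗ₖ (C * Cᴴ)) * Uᴴ) =
      krausMap (fun p : e × e => envSlice (U * ((1 : Matrix n n ℂ) ⊗ₖ C)) p.1 p.2) σ := by
  have h1 : U * (σ ⊗ₖ (C * Cᴴ)) * Uᴴ = (U * ((1 : Matrix n n ℂ) ⊗ₖ C)) *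
      (σ ⊗ₖ (1 : Matrix e e ℂ)) * (U * ((1 : Matrix n n ℂ) ⊗ₖ C))ᴴ := by
    rw [conjTranspose_mul, conjTranspose_kronecker, conjTranspose_one]
    simp only [Matrix.mul_assoc]
    rw [← Matrix.mul_assoc (σ ⊗ₖ _), ← Matrix.mul_assoc (1 ⊗ₖ C), ← mul_kronecker_mul,
      ← mul_kronecker_mul]
    simp
  have h2 : ∀ M : Matrix (n × e) (n × e) ℂ, traceEnv M = ∑ b, envSlice M b b := fun M => by
    ext x y
    simp [traceEnv, envSlice_apply, Matrix.sum_apply]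
  have h3 : ∀ c d : e, envSlice (σ ⊗ₖ (1 : Matrix e e ℂ)) c d = if c = d then σ else 0 := by
    intro c d
    ext x y
    by_cases h : c = d <;> simp [envSlice_apply, h]
  rw [h1, h2, krausMap_apply, Fintype.sum_prod_type]
  simp [envSlice_mul, envSlice_conjTranspose, h3, conjTranspose_sum]

end envSlice

/-! ### Calculus of block operators on `⨁ⱼ Jⱼ ⊗ Kⱼ`. -/

namespace TensorDecomposition

variable {n : Type*} [Fintype n] [DecidableEq n] (D : TensorDecomposition n)

/-- Operators on `Jⱼ ⊗ Kⱼ`. -/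
abbrev OpJK (j : Fin D.m) : Type :=
  Matrix (Fin (D.dJ j) × Fin (D.dK j)) (Fin (D.dJ j) × Fin (D.dK j)) ℂ

instance (j : Fin D.m) : NeZero (D.dJ j) := ⟨(D.dJ_pos j).ne'⟩

instance (j : Fin D.m) : NeZero (D.dK j) := ⟨(D.dK_pos j).ne'⟩

/-- The index set of the product basis of `⨁ⱼ Jⱼ ⊗ Kⱼ`. -/
abbrev Idx : Type := Σ j, Fin (D.dJ j) × Fin (D.dK j)

lemma conj_mul_conj (A B : Matrix D.Idx D.Idx ℂ) :
    (D.W * A * D.Wᴴ) * (D.W * B * D.Wᴴ) = D.W * (A * B) * D.Wᴴ := by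
  simp only [Matrix.mul_assoc]
  rw [← Matrix.mul_assoc D.Wᴴ D.W, D.conjTranspose_mul_self, Matrix.one_mul]

lemma frame_conj (A : Matrix D.Idx D.Idx ℂ) : D.Wᴴ * (D.W * A * D.Wᴴ) * D.W = A := by
  simp only [Matrix.mul_assoc]
  rw [← Matrix.mul_assoc D.Wᴴ D.W, D.conjTranspose_mul_self, Matrix.one_mul, Matrix.mul_one]

lemma conj_frame (Y : Matrix n n ℂ) : D.W * (D.Wᴴ * Y * D.W) * D.Wᴴ = Y := by
  simp only [Matrix.mul_assoc]
  rw [← Matrix.mul_assoc D.W D.Wᴴ, D.mul_conjTranspose_self, Matrix.one_mul, Matrix.mul_one]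

lemma frame_directSum (X : ∀ j, D.OpJK j) : D.Wᴴ * D.directSum X * D.W = blockDiagonal' X :=
  D.frame_conj _

lemma directSum_injective {X Y : ∀ j, D.OpJK j} (h : D.directSum X = D.directSum Y) : X = Y := by
  apply blockDiagonal'_injective
  rw [← D.frame_directSum X, h, D.frame_directSum]

lemma directSum_mul (X Y : ∀ j, D.OpJK j) :
    D.directSum X * D.directSum Y = D.directSum fun j => X j * Y j := by
  rw [directSum, directSum, conj_mul_conj, directSum, blockDiagonal'_mul]

lemma directSum_conjTranspose (X : ∀ j, D.OpJK j) :
    (D.directSum X)ᴴ = D.directSum fun j => (X j)ᴴ := by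
  simp [directSum, conjTranspose_mul, blockDiagonal'_conjTranspose, Matrix.mul_assoc]

lemma directSum_sum {ι : Type*} [Fintype ι] (X : ι → ∀ j, D.OpJK j) :
    ∑ i, D.directSum (X i) = D.directSum fun j => ∑ i, X i j := by
  have : ∑ i, blockDiagonal' (X i) = blockDiagonal' fun j => ∑ i, X i j := by
    rw [← Finset.sum_fn]
    exact (map_sum (blockDiagonal'AddMonoidHom (fun j => Fin (D.dJ j) × Fin (D.dK j))
      (fun j => Fin (D.dJ j) × Fin (D.dK j)) ℂ) X Finset.univ).symm
  simp only [directSum]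
  rw [← this, Matrix.mul_sum, Matrix.sum_mul]

lemma directSum_one : D.directSum (fun _ => 1) = 1 := by
  have : blockDiagonal' (fun j : Fin D.m => (1 : D.OpJK j)) = 1 := blockDiagonal'_one
  rw [directSum, this, Matrix.mul_one, D.mul_conjTranspose_self]

lemma directSum_smul (c : ℂ) (X : ∀ j, D.OpJK j) :
    c • D.directSum X = D.directSum fun j => c • X j := by
  have : blockDiagonal' (fun j => c • X j) = c • blockDiagonal' X := blockDiagonal'_smul c X
  simp [directSum, this]

lemma embed_eq_directSum (j : Fin D.m) (X : D.OpJK j) :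
    D.embed j X = D.directSum (Pi.single j X) := by
  ext x y
  simp only [embed, directSum, incl, Matrix.mul_apply, Fintype.sum_sigma, submatrix_apply,
    conjTranspose_apply, id]
  rw [Finset.sum_eq_single j]
  · refine Finset.sum_congr rfl fun p _ => ?_
    congr 1
    rw [Finset.sum_eq_single j]
    · simp [blockDiagonal'_apply_eq]
    · intro k _ hk
      refine Finset.sum_eq_zero fun q _ => ?_
      rw [blockDiagonal'_apply_ne _ _ _ hk, mul_zero]
    · simp
  · intro k _ hk
    refine Finset.sum_eq_zero fun p _ => ?_
    rw [Finset.sum_eq_zero, zero_mul]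
    intro l _
    refine Finset.sum_eq_zero fun q _ => ?_
    by_cases h : l = k
    · subst h
      simp [blockDiagonal'_apply_eq, hk]
    · rw [blockDiagonal'_apply_ne _ _ _ h, mul_zero]
  · simp

lemma envSlice_directSumEnv {e : Type*} [Fintype e] [DecidableEq e] (V : ∀ j, D.OpKE e j)
    (b a : e) :
    envSlice (D.directSumEnv V) b a = D.directSum fun j => 1 ⊗ₖ envSlice (V j) b a := by
  ext x y
  simp only [envSlice_apply, directSumEnv, directSum, Matrix.mul_apply, Fintype.sum_prod_type,
    kroneckerMap_apply, conjTranspose_apply, Matrix.one_apply, mul_ite, mul_one, mul_zero, ite_mul,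
    zero_mul, Finset.sum_ite_eq, Finset.mem_univ, if_true, apply_ite star, star_zero]
  refine Finset.sum_congr rfl fun p _ => ?_
  congr 1
  refine Finset.sum_congr rfl fun q _ => ?_
  congr 1
  obtain ⟨j, c⟩ := p
  obtain ⟨k, d⟩ := q
  by_cases h : k = j
  · subst h
    simp [blockDiagonal'_apply_eq, Equiv.sigmaProdDistrib, envSlice_apply]
  · rw [blockDiagonal'_apply_ne _ _ _ h]
    simp [Equiv.sigmaProdDistrib, blockDiagonal'_apply_ne _ _ _ h]

lemma one_kronecker_of_directSum_eq {X Y : ∀ j, D.OpK j}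
    (h : (D.directSum fun j => 1 ⊗ₖ X j) = D.directSum fun j => 1 ⊗ₖ Y j) (j : Fin D.m) :
    X j = Y j :=
  one_kronecker_injective (congrFun (D.directSum_injective h) j)

lemma krausMap_embed {ι : Type*} [Fintype ι] (N : ι → ∀ j, D.OpK j) (j : Fin D.m)
    (A : D.OpJ j) (B : D.OpK j) :
    krausMap (fun i => D.directSum fun j => 1 ⊗ₖ N i j) (D.embed j (A ⊗ₖ B)) =
      D.embed j (A ⊗ₖ krausMap (fun i => N i j) B) := by
  simp only [embed_eq_directSum, krausMap_apply, directSum_mul, directSum_conjTranspose,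
    directSum_sum]
  congr 1
  funext k
  by_cases h : k = j
  · subst h
    simp [conjTranspose_kronecker, ← mul_kronecker_mul, sum_kronecker_right]
  · simp [h]

lemma sum_conjTranspose_mul_self_of_directSum {ι : Type*} [Fintype ι] {N : ι → ∀ j, D.OpK j}
    (hN : ∑ i, (D.directSum fun j => 1 ⊗ₖ N i j)ᴴ * (D.directSum fun j => 1 ⊗ₖ N i j) = 1)
    (j : Fin D.m) : ∑ i, (N i j)ᴴ * N i j = 1 := by
  refine D.one_kronecker_of_directSum_eq (X := fun j => ∑ i, (N i j)ᴴ * N i j)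
    (Y := fun j => 1) ?_ j
  simp only [one_kronecker_one, directSum_one, ← hN, directSum_mul, directSum_conjTranspose,
    directSum_sum, conjTranspose_kronecker, ← mul_kronecker_mul, sum_kronecker_right]
  simp

lemma actsBlockwise_of_kraus {ι : Type*} [Fintype ι] {N : ι → ∀ j, D.OpK j} {ω : ∀ j, D.OpK j}
    (hN : ∑ i, (D.directSum fun j => 1 ⊗ₖ N i j)ᴴ * (D.directSum fun j => 1 ⊗ₖ N i j) = 1)
    (hω : ∀ j, krausMap (fun i => N i j) (ω j) = ω j) :
    D.ActsBlockwise ω (krausMap fun i => D.directSum fun j => 1 ⊗ₖ N i j) := by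
  exact ⟨fun j => krausMap fun i => N i j, fun j => isQuantumOperation_krausMap
    (D.sum_conjTranspose_mul_self_of_directSum hN j), hω, D.krausMap_embed N⟩

/-! ### Blockwise action versus block form of representations. -/

/-- The Kraus operators of a blockwise acting map have the form `⨁ⱼ 1 ⊗ Nⱼ`. -/
lemma exists_kraus_eq_directSum {ι : Type*} [Fintype ι] {M : ι → Matrix n n ℂ}
    {ω : ∀ j, D.OpK j} (h : D.ActsBlockwise ω (krausMap M)) :
    ∃ N : ι → ∀ j, D.OpK j, (∀ i, M i = D.directSum fun j => 1 ⊗ₖ N i j) ∧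
      ∀ j, krausMap (fun i => N i j) (ω j) = ω j := by
  obtain ⟨S, -, hSω, hS⟩ := h
  let F : ι → Matrix D.Idx D.Idx ℂ := fun i => D.Wᴴ * M i * D.W
  -- Apply the map to `|a⟩⟨a'| ⊗ |b⟩⟨b|` in block `j`: the left side is an entry of the output, the
  -- right side its known product form.
  have key : ∀ j a a' b p q, ∑ i, F i p ⟨j, a, b⟩ * star (F i q ⟨j, a', b⟩) =
      blockDiagonal' (Pi.single j (Matrix.single a a' 1 ⊗ₖ S j (Matrix.single b b 1)) :
        ∀ j, D.OpJK j) p q := by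
    intro j a a' b p q
    have h1 := hS j (Matrix.single a a' 1) (Matrix.single b b 1)
    have h2 : D.Wᴴ * krausMap M
        (D.W * (Matrix.single ⟨j, a, b⟩ ⟨j, a', b⟩ 1 : Matrix D.Idx D.Idx ℂ) * D.Wᴴ) * D.W =
        ∑ i, F i * Matrix.single ⟨j, a, b⟩ ⟨j, a', b⟩ 1 * (F i)ᴴ := by
      simp only [krausMap_apply, Matrix.mul_sum, Matrix.sum_mul, F, conjTranspose_mul,
        conjTranspose_conjTranspose, Matrix.mul_assoc]
    have h3 : blockDiagonal' (Pi.single j (Matrix.single a a' 1 ⊗ₖ Matrix.single b b 1) :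
        ∀ j, D.OpJK j) = Matrix.single ⟨j, a, b⟩ ⟨j, a', b⟩ 1 := by
      ext ⟨k, c, d⟩ ⟨l, c', d'⟩
      by_cases hk : k = l
      · subst hk
        rw [blockDiagonal'_apply_eq]
        by_cases hj : k = j
        · subst hj
          simp [Matrix.single_apply, Prod.ext_iff]
          grind
        · simp [hj, Ne.symm hj]
      · rw [blockDiagonal'_apply_ne _ _ _ hk, Matrix.single_apply, if_neg]
        rintro ⟨h, h'⟩
        simp only [Sigma.mk.injEq] at h h'
        exact hk (h.1.symm.trans h'.1)
    rw [embed_eq_directSum, embed_eq_directSum, directSum, h3] at h1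
    rw [h1, frame_directSum] at h2
    rw [h2, Matrix.sum_apply]
    refine Finset.sum_congr rfl fun i _ => ?_
    simp [Matrix.mul_apply, Matrix.single_apply, ite_and]
  -- The diagonal output entry for `a = a'` at row `p` is a sum of squares over `i`, and it is zero
  -- unless `p` lies in block `j` with `J`-index `a`.
  have hne : ∀ i j a b p, (∀ b', p ≠ ⟨j, a, b'⟩) → F i p ⟨j, a, b⟩ = 0 := by
    intro i j a b p hp
    refine sum_mul_star_eq_zero (x := fun i => F i p ⟨j, a, b⟩) ?_ i
    rw [key]
    obtain ⟨k, c, d⟩ := p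
    rw [blockDiagonal'_apply_eq]
    by_cases hk : k = j
    · subst hk
      have hc : a ≠ c := by
        rintro rfl
        exact hp d rfl
      simp [hc]
    · simp [hk]
  -- Expanding the squared difference gives four output entries, all equal to the same entry of `S j
  -- (|b⟩⟨b|)`, with signs that cancel.
  have heq : ∀ i j a a' b b', F i ⟨j, a, b'⟩ ⟨j, a, b⟩ = F i ⟨j, a', b'⟩ ⟨j, a', b⟩ := by
    intro i j a a' b b'
    rw [← sub_eq_zero]
    refine sum_mul_star_eq_zero
      (x := fun i => F i ⟨j, a, b'⟩ ⟨j, a, b⟩ - F i ⟨j, a', b'⟩ ⟨j, a', b⟩) ?_ i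
    simp only [star_sub, mul_sub, sub_mul, Finset.sum_sub_distrib, key, blockDiagonal'_apply_eq]
    simp
  let N : ι → ∀ j, D.OpK j := fun i j => of fun b' b => F i ⟨j, 0, b'⟩ ⟨j, 0, b⟩
  have hM : ∀ i, M i = D.directSum fun j => 1 ⊗ₖ N i j := by
    intro i
    rw [directSum, ← D.conj_frame (M i)]
    congr 2
    ext ⟨k, c, d⟩ ⟨l, c', d'⟩
    by_cases hk : k = l
    · subst hk
      rw [blockDiagonal'_apply_eq]
      by_cases hc : c = c'
      · subst hc
        simpa [N] using heq i k c 0 d' d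
      · have := hne i k c' d' ⟨k, c, d⟩ (by simp [hc])
        simpa [hc] using this
    · rw [blockDiagonal'_apply_ne _ _ _ hk]
      exact hne i l c' d' ⟨k, c, d⟩ (by simp [hk])
  refine ⟨N, hM, fun j => ?_⟩
  -- Testing on `1 ⊗ ωⱼ` isolates the action on `Kⱼ`, since `Jⱼ` is nonzero.
  have h1 := hS j 1 (ω j)
  rw [hSω, funext hM, krausMap_embed, embed_eq_directSum, embed_eq_directSum] at h1
  have h2 := congrFun (D.directSum_injective h1) j
  simp only [Pi.single_eq_same] at h2
  exact one_kronecker_injective h2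

end TensorDecomposition

lemma PosSemidef.exists_eq_mul_conjTranspose_self {n : Type*} [Fintype n]
    {A : Matrix n n ℂ} (hA : A.PosSemidef) : ∃ C : Matrix n n ℂ, A = C * Cᴴ := by
  obtain ⟨B, hB⟩ := PosSemidef.exists_eq_conjTranspose_mul_self hA
  exact ⟨Bᴴ, by rw [hB, conjTranspose_conjTranspose]⟩

namespace TensorDecomposition

variable {n : Type*} [Fintype n] [DecidableEq n] (D : TensorDecomposition n)

lemma directSum_one_kronecker_smul_one (c : ℂ) :
    (D.directSum fun j => (1 : D.OpJ j) ⊗ₖ (c • (1 : D.OpK j))) = c • 1 := by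
  rw [← D.directSum_one, directSum_smul]
  simp [kronecker_smul]

lemma directSumEnv_mul_one_kronecker {e : Type*} [Fintype e] [DecidableEq e]
    (V : ∀ j, D.OpKE e j) (C : Matrix e e ℂ) :
    D.directSumEnv V * ((1 : Matrix n n ℂ) ⊗ₖ C) =
      D.directSumEnv fun j => V j * ((1 : D.OpK j) ⊗ₖ C) := by
  refine envSlice_ext fun b a => ?_
  simp only [envSlice_mul, envSlice_directSumEnv, envSlice_one_kronecker, mul_smul_comm, mul_one,
    directSum_smul, directSum_sum, ← kronecker_smul, sum_kronecker_right]

lemma directSumEnv_injective {e : Type*} [Fintype e] [DecidableEq e]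
    {V V' : ∀ j, D.OpKE e j} (h : D.directSumEnv V = D.directSumEnv V') (j : Fin D.m) :
    V j = V' j := by
  refine envSlice_ext fun b a => ?_
  have := congrArg (fun M => envSlice M b a) h
  simp only [envSlice_directSumEnv] at this
  exact D.one_kronecker_of_directSum_eq this j

lemma directSumEnv_one_kronecker {e : Type*} [Fintype e] [DecidableEq e] (C : Matrix e e ℂ) :
    (D.directSumEnv fun _ => 1 ⊗ₖ C) = 1 ⊗ₖ C := by
  refine envSlice_ext fun b a => ?_
  simp only [envSlice_directSumEnv, envSlice_one_kronecker, directSum_one_kronecker_smul_one]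

lemma directSumEnv_gram {e : Type*} [Fintype e] [DecidableEq e] (V : ∀ j, D.OpKE e j) :
    (D.directSumEnv V)ᴴ * D.directSumEnv V = D.directSumEnv fun j => (V j)ᴴ * V j := by
  refine envSlice_ext fun b a => ?_
  simp only [envSlice_mul, envSlice_conjTranspose, envSlice_directSumEnv, directSum_conjTranspose,
    directSum_mul, directSum_sum, conjTranspose_kronecker, conjTranspose_one, ← mul_kronecker_mul,
    mul_one, sum_kronecker_right]

/-- The representation of a blockwise acting map is, on `H ⊗ supp ε`, of block form. -/
lemma hasBlockForm_of_actsBlockwise {ω : ∀ j, D.OpK j}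
    {T : Matrix n n ℂ →ₗ[ℂ] Matrix n n ℂ} (hT : D.ActsBlockwise ω T)
    {e : Type*} [Fintype e] [DecidableEq e] {ε : Matrix e e ℂ}
    {U : Matrix (n × e) (n × e) ℂ} (hU : IsStinespring T ε U) : D.HasBlockForm ω ε U := by
  obtain ⟨C, hC⟩ := PosSemidef.exists_eq_mul_conjTranspose_self hU.isDensity.posSemidef
  set F := U * ((1 : Matrix n n ℂ) ⊗ₖ C) with hF
  have hTk : T = krausMap fun p : e × e => envSlice F p.1 p.2 := by
    refine LinearMap.ext fun σ => ?_
    rw [hU.map_eq, hC, traceEnv_eq_krausMap]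
  rw [hTk] at hT
  obtain ⟨N, hN, hNω⟩ := D.exists_kraus_eq_directSum hT
  let N' : ∀ j, D.OpKE e j := fun j => of fun x y => N (x.2, y.2) j x.1 y.1
  have hFN : F = D.directSumEnv N' := by
    refine envSlice_ext fun b a => ?_
    rw [envSlice_directSumEnv]
    exact hN (b, a)
  -- Unitarity of `U` makes the Gram matrices of `F = U (1 ⊗ C)` and `1 ⊗ C` agree, and this can be
  -- read block by block. Hence `N' j = V j (1 ⊗ C)` with `V j` unitary on `Kⱼ ⊗ E`.
  have hgram : ∀ j, (N' j)ᴴ * N' j = ((1 : D.OpK j) ⊗ₖ C)ᴴ * ((1 : D.OpK j) ⊗ₖ C) := by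
    refine D.directSumEnv_injective ?_
    rw [← directSumEnv_gram, ← hFN, ← directSumEnv_gram, directSumEnv_one_kronecker, hF,
      conjTranspose_mul, Matrix.mul_assoc, ← Matrix.mul_assoc Uᴴ, ← star_eq_conjTranspose U,
      mem_unitaryGroup_iff'.mp hU.unitary, Matrix.one_mul]
  choose V hV hNV using fun j => exists_unitary_eq_mul (hgram j)
  have hε : ∀ {m : Type _} [Fintype m] [DecidableEq m],
      (1 : Matrix m m ℂ) ⊗ₖ ε = (1 ⊗ₖ C) * (1 ⊗ₖ Cᴴ) := by
    intro m _ _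
    rw [← mul_kronecker_mul, ← hC, Matrix.mul_one]
  have hUV : U * ((1 : Matrix n n ℂ) ⊗ₖ ε) = D.directSumEnv V * ((1 : Matrix n n ℂ) ⊗ₖ ε) := by
    rw [hε, ← Matrix.mul_assoc, ← Matrix.mul_assoc, directSumEnv_mul_one_kronecker, ← hF, hFN]
    simp only [← hNV]
  refine ⟨V, hV, fun j => ?_, hUV, fun hpos => ?_⟩
  · rw [hC, traceEnv_eq_krausMap, ← hNV]
    exact hNω j
  · have hunit : IsUnit ((1 : Matrix n n ℂ) ⊗ₖ ε) :=
      (PosDef.one.kronecker hpos).isUnit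
    exact hunit.mul_right_cancel hUV

/-- Every quantum operation has a representation by a unitary and a pure environment state. -/
lemma exists_isStinespring {T : Matrix n n ℂ →ₗ[ℂ] Matrix n n ℂ} (hT : IsQuantumOperation T) :
    ∃ (e : Type) (_ : Fintype e) (_ : DecidableEq e) (a₀ : e) (U : Matrix (n × e) (n × e) ℂ),
      IsStinespring T (Matrix.single a₀ a₀ 1) U := by
  obtain ⟨M₀, hM₀, hsum₀⟩ := hT.exists_krausMap
  let r := Fintype.card (n × n)
  let f : Fin r ≃ n × n := (Fintype.equivFin (n × n)).symm
  -- The index set is rebuilt from `Fin r` to land in `Type`. The extra index `none`, with Kraus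
  -- operator zero, supplies the initial environment state even when `r = 0`.
  let M : Option (Fin r) → Matrix n n ℂ := fun i => i.elim 0 fun i => M₀ (f i)
  have hM : T = krausMap M := by
    refine LinearMap.ext fun σ => ?_
    simp only [hM₀, krausMap_apply, Fintype.sum_option, M, Option.elim]
    simp [f.sum_comp fun i => M₀ i * σ * (M₀ i)ᴴ]
  have hsum : ∑ i, (M i)ᴴ * M i = 1 := by
    simp only [Fintype.sum_option, M, Option.elim]
    simp [f.sum_comp fun i => (M₀ i)ᴴ * M₀ i, hsum₀]
  -- The Stinespring isometry `ψ ⊗ |none⟩ ↦ ∑ b, M b ψ ⊗ |b⟩`, padded by zero to a square matrix.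
  -- Its Gram matrix is the projection `1 ⊗ |none⟩⟨none|`, so it agrees with a unitary on the range
  -- of that projection.
  let A : Matrix (n × Option (Fin r)) (n × Option (Fin r)) ℂ :=
    of fun x y => if y.2 = none then M x.2 x.1 y.1 else 0
  have hA : ∀ b a, envSlice A b a = if a = none then M b else 0 := by
    intro b a
    ext x y
    by_cases h : a = none <;> simp [envSlice_apply, A, h]
  let B : Matrix (n × Option (Fin r)) (n × Option (Fin r)) ℂ :=
    1 ⊗ₖ Matrix.single none none 1
  have hgram : Aᴴ * A = Bᴴ * B := by
    have hB : Bᴴ * B = 1 ⊗ₖ Matrix.single none none 1 := by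
      simp [B, conjTranspose_kronecker, ← mul_kronecker_mul]
    rw [hB]
    refine envSlice_ext fun b a => ?_
    rw [envSlice_mul, envSlice_one_kronecker]
    simp only [envSlice_conjTranspose, hA]
    rcases a with _ | a <;> rcases b with _ | b <;> simp [hsum]
  obtain ⟨U, hU, hAU⟩ := exists_unitary_eq_mul hgram
  refine ⟨Option (Fin r), inferInstance, inferInstance, none, U, ⟨?_, ?_⟩, hU, fun σ => ?_⟩
  · rw [← diagonal_single (none : Option (Fin r)) (1 : ℂ), posSemidef_diagonal_iff]
    intro i
    by_cases hi : i = none <;> simp [hi]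
  · simp
  · have hs : (Matrix.single none none 1 : Matrix (Option (Fin r)) (Option (Fin r)) ℂ) =
        Matrix.single none none 1 * (Matrix.single none none 1)ᴴ := by simp
    rw [hs, traceEnv_eq_krausMap, ← hAU, hM]
    simp only [krausMap_apply, hA, Fintype.sum_prod_type]
    refine Finset.sum_congr rfl fun b _ => ?_
    rw [Finset.sum_eq_single none] <;> simp +contextual

/-- A map all of whose representations are of block form acts blockwise. -/
lemma actsBlockwise_of_hasBlockForm {ω : ∀ j, D.OpK j}
    {T : Matrix n n ℂ →ₗ[ℂ] Matrix n n ℂ} (hT : IsQuantumOperation T)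
    (h : ∀ (e : Type) [Fintype e] [DecidableEq e] (ε : Matrix e e ℂ)
      (U : Matrix (n × e) (n × e) ℂ), IsStinespring T ε U → D.HasBlockForm ω ε U) :
    D.ActsBlockwise ω T := by
  -- One pure representation is enough: `ε` is a projection, so it serves as its own factor `C`, and
  -- block form on `H ⊗ supp ε` fixes all slices of `U (1 ⊗ C)`.
  obtain ⟨e, _, _, a₀, U, hU⟩ := exists_isStinespring hT
  obtain ⟨V, -, hVω, hUV, -⟩ := h e _ U hU
  have hs : (Matrix.single a₀ a₀ 1 : Matrix e e ℂ) =
      Matrix.single a₀ a₀ 1 * (Matrix.single a₀ a₀ 1)ᴴ := by simp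
  let N : e × e → ∀ j, D.OpK j := fun p j =>
    envSlice (V j * ((1 : D.OpK j) ⊗ₖ Matrix.single a₀ a₀ 1)) p.1 p.2
  have hTk : T = krausMap fun p => D.directSum fun j => 1 ⊗ₖ N p j := by
    refine LinearMap.ext fun σ => ?_
    rw [hU.map_eq, hs, traceEnv_eq_krausMap, hUV, directSumEnv_mul_one_kronecker]
    simp only [envSlice_directSumEnv, N]
  rw [hTk]
  refine D.actsBlockwise_of_kraus ?_ fun j => ?_
  · refine sum_conjTranspose_mul_self_of_trace ?_
    rw [← hTk]
    exact hT.trace_map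
  · have := hVω j
    rw [hs, traceEnv_eq_krausMap] at this
    exact this

end TensorDecomposition

/-! ### Reduction of star-closed families and isotypic components. -/

/-- A family of matrices without non-scalar commutant. -/
def IsIrreducibleFamily {σ n : Type*} [Fintype n] [DecidableEq n] (π : σ → Matrix n n ℂ) : Prop :=
  ∀ Y : Matrix n n ℂ, (∀ s, π s * Y = Y * π s) → ∃ c : ℂ, Y = c • 1

/-- A family of matrices closed under taking adjoints. -/
def IsStarClosed {σ n : Type*} (π : σ → Matrix n n ℂ) : Prop :=
  ∀ s, ∃ t, π t = (π s)ᴴ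

/-- Star-closure puts `Yᴴ` into the commutant along with `Y`. If both `Y + Yᴴ` and `i (Y - Yᴴ)` were
scalar, so would be `Y`. -/
lemma exists_isHermitian_of_not_isIrreducibleFamily {σ n : Type*} [Fintype n] [DecidableEq n]
    {π : σ → Matrix n n ℂ} (hπ : IsStarClosed π) (h : ¬ IsIrreducibleFamily π) :
    ∃ H : Matrix n n ℂ, H.IsHermitian ∧ (∀ s, π s * H = H * π s) ∧ ∀ c : ℂ, H ≠ c • 1 := by
  unfold IsIrreducibleFamily at h
  push Not at h
  obtain ⟨Y, hY, hYc⟩ := h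
  have hY' : ∀ s, π s * Yᴴ = Yᴴ * π s := by
    intro s
    obtain ⟨t, ht⟩ := hπ s
    have := congrArg conjTranspose (hY t)
    simpa [conjTranspose_mul, ht] using this.symm
  by_cases h1 : ∀ c : ℂ, Y + Yᴴ ≠ c • 1
  · exact ⟨Y + Yᴴ, isHermitian_add_transpose_self Y, fun s => by
      rw [Matrix.mul_add, Matrix.add_mul, hY, hY'], h1⟩
  push Not at h1
  obtain ⟨c, hc⟩ := h1
  refine ⟨Complex.I • (Y - Yᴴ), ?_, fun s => ?_, fun c' hc' => hYc ((c - Complex.I * c') / 2) ?_⟩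
  · simp only [IsHermitian, conjTranspose_smul, conjTranspose_sub, conjTranspose_conjTranspose,
      Complex.star_def, Complex.conj_I]
    module
  · rw [Matrix.mul_smul, Matrix.smul_mul, Matrix.mul_sub, Matrix.sub_mul, hY, hY']
  · have h2 : (c - Complex.I * c') • (1 : Matrix n n ℂ) = (2 : ℂ) • Y := by
      rw [sub_smul, mul_smul, ← hc, ← hc', smul_smul, Complex.I_mul_I]
      module
    rw [div_eq_inv_mul, mul_smul, h2, smul_smul]
    norm_num

/-- A reducible star-closed family splits along two orthogonal subspaces. -/
lemma exists_reducing_isometries {σ n : Type*} [Fintype n] [DecidableEq n]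
    {π : σ → Matrix n n ℂ} (hπ : IsStarClosed π) (h : ¬ IsIrreducibleFamily π) :
    ∃ (p : n → Prop) (_ : DecidablePred p) (V₁ : Matrix n {x // p x} ℂ)
      (V₂ : Matrix n {x // ¬ p x} ℂ), (∃ x, p x) ∧ (∃ x, ¬ p x) ∧
      V₁ᴴ * V₁ = 1 ∧ V₂ᴴ * V₂ = 1 ∧ V₁ᴴ * V₂ = 0 ∧ V₁ * V₁ᴴ + V₂ * V₂ᴴ = 1 ∧
      ∀ s, V₁ᴴ * π s * V₂ = 0 := by
  classical
  obtain ⟨H, hH, hcomm, hns⟩ := exists_isHermitian_of_not_isIrreducibleFamily hπ h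
  set U : Matrix n n ℂ := (hH.eigenvectorUnitary : Matrix n n ℂ) with hU
  have hUU : Uᴴ * U = 1 := mem_unitaryGroup_iff'.mp hH.eigenvectorUnitary.2
  have hUU' : U * Uᴴ = 1 := mem_unitaryGroup_iff.mp hH.eigenvectorUnitary.2
  set Λ : Matrix n n ℂ := diagonal (fun i => (hH.eigenvalues i : ℂ)) with hΛ
  have hspec : H = U * Λ * Uᴴ := by
    have := hH.spectral_theorem
    rw [Unitary.conjStarAlgAut_apply] at this
    exact this
  have hR : ∀ s, (Uᴴ * π s * U) * Λ = Λ * (Uᴴ * π s * U) := by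
    intro s
    have h1 : Λ = Uᴴ * H * U := by
      rw [hspec]
      simp only [Matrix.mul_assoc, hUU, Matrix.mul_one]
      rw [← Matrix.mul_assoc, hUU, Matrix.one_mul]
    calc Uᴴ * π s * U * Λ = Uᴴ * π s * (U * Uᴴ) * H * U := by
          rw [h1]; simp only [Matrix.mul_assoc]
      _ = Uᴴ * (π s * H) * U := by rw [hUU']; simp only [Matrix.mul_assoc, Matrix.one_mul]
      _ = Uᴴ * H * (U * Uᴴ) * π s * U := by
          rw [hcomm, hUU']; simp only [Matrix.mul_assoc, Matrix.one_mul]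
      _ = _ := by rw [h1]; simp only [Matrix.mul_assoc]
  have hne : ∃ a b, hH.eigenvalues a ≠ hH.eigenvalues b := by
    by_contra! hcon
    rcases isEmpty_or_nonempty n with he | ⟨⟨a⟩⟩
    · exact hns 0 (Subsingleton.elim _ _)
    · refine hns (hH.eigenvalues a) ?_
      have : Λ = (hH.eigenvalues a : ℂ) • 1 := by
        rw [hΛ, smul_one_eq_diagonal]
        congr 1
        funext i
        rw [hcon i a]
      refine hspec.trans ?_
      rw [this]
      simp [hUU']
  obtain ⟨a, b, hab⟩ := hne
  -- The splitting separates one eigenspace of the Hermitian `H` from the others. In the eigenbasis,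
  -- each member of the family commutes with a diagonal matrix, so its entries between different
  -- eigenvalues vanish.
  let p : n → Prop := fun x => hH.eigenvalues x = hH.eigenvalues a
  have hsub : ∀ (q r : n → Prop) (A : Matrix n n ℂ),
      (U.submatrix id (Subtype.val : {x // q x} → n))ᴴ * A *
        U.submatrix id (Subtype.val : {x // r x} → n) =
      (Uᴴ * A * U).submatrix Subtype.val Subtype.val := by
    intro q r A
    ext x y
    simp [Matrix.mul_apply, Matrix.submatrix_apply]
  have hsub1 : ∀ (q r : n → Prop),
      (U.submatrix id (Subtype.val : {x // q x} → n))ᴴ *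
        U.submatrix id (Subtype.val : {x // r x} → n) =
      (1 : Matrix n n ℂ).submatrix Subtype.val Subtype.val := by
    intro q r
    have := hsub q r 1
    rwa [Matrix.mul_one, Matrix.mul_one, hUU] at this
  refine ⟨p, inferInstance, U.submatrix id Subtype.val, U.submatrix id Subtype.val,
    ⟨a, rfl⟩, ⟨b, hab.symm⟩, ?_, ?_, ?_, ?_, fun s => ?_⟩
  · rw [hsub1, submatrix_one _ Subtype.val_injective]
  · rw [hsub1, submatrix_one _ Subtype.val_injective]
  · rw [hsub1]
    ext x y
    have : (x : n) ≠ y := fun h => y.2 (h ▸ x.2)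
    simp [this]
  · rw [← hUU']
    ext x y
    simp only [Matrix.add_apply, Matrix.mul_apply, submatrix_apply, conjTranspose_apply, id]
    exact Fintype.sum_subtype_add_sum_subtype p fun i => U x i * star (U y i)
  · rw [hsub]
    ext x y
    have h1 := congrFun (congrFun (hR s) x) y
    simp only [hΛ, mul_diagonal, diagonal_mul] at h1
    have h2 : (hH.eigenvalues y : ℂ) - hH.eigenvalues x ≠ 0 := by
      rw [sub_ne_zero]
      intro h
      exact y.2 ((Complex.ofReal_injective h).trans x.2)
    have h3 : (Uᴴ * π s * U) x y * ((hH.eigenvalues y : ℂ) - hH.eigenvalues x) = 0 := by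
      rw [mul_sub, h1]
      ring
    simpa [h2] using h3

lemma IsStarClosed.conj {σ n m : Type*} [Fintype n] {π : σ → Matrix n n ℂ} (hπ : IsStarClosed π)
    (V : Matrix n m ℂ) : IsStarClosed fun s => Vᴴ * π s * V := by
  intro s
  obtain ⟨t, ht⟩ := hπ s
  exact ⟨t, by simp [ht, conjTranspose_mul, Matrix.mul_assoc]⟩

lemma conjTranspose_mul_mul_mul {n k₁ k₂ l₁ l₂ : Type*} [Fintype n] [Fintype k₁] [Fintype k₂]
    (A : Matrix n k₁ ℂ) (B : Matrix n k₂ ℂ) (X : Matrix k₁ l₁ ℂ) (Y : Matrix k₂ l₂ ℂ)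
    (Z : Matrix n n ℂ) : (A * X)ᴴ * Z * (B * Y) = Xᴴ * (Aᴴ * Z * B) * Y := by
  simp only [conjTranspose_mul, Matrix.mul_assoc]

lemma conjTranspose_mul_mul {n k₁ k₂ l₁ l₂ : Type*} [Fintype n] [Fintype k₁] [Fintype k₂]
    (A : Matrix n k₁ ℂ) (B : Matrix n k₂ ℂ) (X : Matrix k₁ l₁ ℂ) (Y : Matrix k₂ l₂ ℂ) :
    (A * X)ᴴ * (B * Y) = Xᴴ * (Aᴴ * B) * Y := by
  simp only [conjTranspose_mul, Matrix.mul_assoc]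

lemma sum_mul_conjTranspose_of_isometries {n k ι : Type*} [Fintype k] [DecidableEq k] [Fintype ι]
    {d : ι → ℕ} (A : Matrix n k ℂ) {X : ∀ i, Matrix k (Fin (d i)) ℂ}
    (hX : ∑ i, X i * (X i)ᴴ = 1) : ∑ i, (A * X i) * (A * X i)ᴴ = A * Aᴴ := by
  calc _ = A * (∑ i, X i * (X i)ᴴ) * Aᴴ := by
        simp only [Matrix.mul_sum, Matrix.sum_mul, conjTranspose_mul, Matrix.mul_assoc]
    _ = _ := by rw [hX, Matrix.mul_one]

/-- Orthogonal decomposition into irreducible subspaces. -/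
lemma exists_irreducible_decomposition {σ : Type*} {n : Type*} [Fintype n] [DecidableEq n]
    (π : σ → Matrix n n ℂ) (hπ : IsStarClosed π) :
    ∃ (ι : Type) (_ : Fintype ι) (d : ι → ℕ) (V : ∀ i, Matrix n (Fin (d i)) ℂ),
      (∀ i, 0 < d i) ∧ (∀ i, (V i)ᴴ * V i = 1) ∧ (∀ i k, i ≠ k → (V i)ᴴ * V k = 0) ∧
      ∑ i, V i * (V i)ᴴ = 1 ∧ (∀ i k s, i ≠ k → (V i)ᴴ * π s * V k = 0) ∧
      ∀ i, IsIrreducibleFamily fun s => (V i)ᴴ * π s * V i := by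
  classical
  induction hN : Fintype.card n using Nat.strong_induction_on generalizing n with
  | _ N ih =>
  subst hN
  by_cases hirr : IsIrreducibleFamily π
  -- The zero space counts as irreducible but must contribute no summand, as the dimensions are
  -- required positive.
  · rcases isEmpty_or_nonempty n with he | hne
    · exact ⟨Empty, inferInstance, Empty.elim, fun i => i.elim, fun i => i.elim, fun i => i.elim,
        fun i => i.elim, Subsingleton.elim _ _, fun i => i.elim, fun i => i.elim⟩
    · let f := Fintype.equivFin n
      let V : Matrix n (Fin (Fintype.card n)) ℂ := (1 : Matrix n n ℂ).submatrix id f.symm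
      have hV : Vᴴ * V = 1 := by
        rw [conjTranspose_submatrix, conjTranspose_one,
          ← submatrix_mul _ _ _ id _ Function.bijective_id, Matrix.mul_one, submatrix_one_equiv]
      have hV' : V * Vᴴ = 1 := by
        rw [conjTranspose_submatrix, conjTranspose_one, submatrix_mul_equiv, Matrix.mul_one,
          submatrix_id_id]
      refine ⟨Unit, inferInstance, fun _ => Fintype.card n, fun _ => V,
        fun _ => Fintype.card_pos, fun _ => hV, fun i k h => (h rfl).elim, by simpa using hV',
        fun i k _ h => (h rfl).elim, fun _ Y hY => ?_⟩
      obtain ⟨c, hc⟩ := hirr (V * Y * Vᴴ) fun s => by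
        calc π s * (V * Y * Vᴴ) = (V * Vᴴ) * π s * V * Y * Vᴴ := by
              rw [hV']; simp only [Matrix.mul_assoc, Matrix.one_mul]
          _ = V * ((Vᴴ * π s * V) * Y) * Vᴴ := by simp only [Matrix.mul_assoc]
          _ = V * Y * Vᴴ * π s * (V * Vᴴ) := by rw [hY]; simp only [Matrix.mul_assoc]
          _ = _ := by rw [hV', Matrix.mul_one]
      refine ⟨c, ?_⟩
      calc Y = (Vᴴ * V) * Y * (Vᴴ * V) := by rw [hV, Matrix.one_mul, Matrix.mul_one]
        _ = Vᴴ * (V * Y * Vᴴ) * V := by simp only [Matrix.mul_assoc]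
        _ = c • 1 := by rw [hc]; simp [hV]
  · obtain ⟨p, _, V₁, V₂, ⟨x, hx⟩, ⟨y, hy⟩, h11, h22, h12, hsum, hπ12⟩ :=
      exists_reducing_isometries hπ hirr
    have h21 : V₂ᴴ * V₁ = 0 := by
      have := congrArg conjTranspose h12
      simpa [conjTranspose_mul] using this
    have hπ21 : ∀ s, V₂ᴴ * π s * V₁ = 0 := by
      intro s
      obtain ⟨t, ht⟩ := hπ s
      have := congrArg conjTranspose (hπ12 t)
      simpa [conjTranspose_mul, ht, Matrix.mul_assoc] using this
    obtain ⟨ι₁, _, d₁, W₁, hd₁, hW₁, ho₁, hs₁, hz₁, hi₁⟩ :=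
      ih _ (Fintype.card_subtype_lt (p := p) (x := y) hy) _ (hπ.conj V₁) rfl
    obtain ⟨ι₂, _, d₂, W₂, hd₂, hW₂, ho₂, hs₂, hz₂, hi₂⟩ :=
      ih _ (Fintype.card_subtype_lt (p := fun x => ¬ p x) (x := x) (by simpa using hx)) _
        (hπ.conj V₂) rfl
    refine ⟨ι₁ ⊕ ι₂, inferInstance, Sum.elim d₁ d₂,
      fun i => Sum.rec (motive := fun i => Matrix n (Fin (Sum.elim d₁ d₂ i)) ℂ)
        (fun i => V₁ * W₁ i) (fun i => V₂ * W₂ i) i, ?_, ?_, ?_, ?_, ?_, ?_⟩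
    · rintro (i | i)
      exacts [hd₁ i, hd₂ i]
    · rintro (i | i)
      · have := conjTranspose_mul_mul V₁ V₁ (W₁ i) (W₁ i)
        rw [h11, Matrix.mul_one, hW₁] at this
        exact this
      · have := conjTranspose_mul_mul V₂ V₂ (W₂ i) (W₂ i)
        rw [h22, Matrix.mul_one, hW₂] at this
        exact this
    · rintro (i | i) (k | k) hik
      · have := conjTranspose_mul_mul V₁ V₁ (W₁ i) (W₁ k)
        rw [h11, Matrix.mul_one, ho₁ i k fun h => hik (congrArg _ h)] at this
        exact this
      · have := conjTranspose_mul_mul V₁ V₂ (W₁ i) (W₂ k)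
        rw [h12, Matrix.mul_zero, Matrix.zero_mul] at this
        exact this
      · have := conjTranspose_mul_mul V₂ V₁ (W₂ i) (W₁ k)
        rw [h21, Matrix.mul_zero, Matrix.zero_mul] at this
        exact this
      · have := conjTranspose_mul_mul V₂ V₂ (W₂ i) (W₂ k)
        rw [h22, Matrix.mul_one, ho₂ i k fun h => hik (congrArg _ h)] at this
        exact this
    · rw [Fintype.sum_sum_type, ← hsum]
      exact congrArg₂ _ (sum_mul_conjTranspose_of_isometries V₁ hs₁)
        (sum_mul_conjTranspose_of_isometries V₂ hs₂)
    · rintro (i | i) (k | k) s hik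
      · exact (conjTranspose_mul_mul_mul V₁ V₁ (W₁ i) (W₁ k) (π s)).trans
          (hz₁ i k s fun h => hik (congrArg _ h))
      · have := conjTranspose_mul_mul_mul V₁ V₂ (W₁ i) (W₂ k) (π s)
        rw [hπ12, Matrix.mul_zero, Matrix.zero_mul] at this
        exact this
      · have := conjTranspose_mul_mul_mul V₂ V₁ (W₂ i) (W₁ k) (π s)
        rw [hπ21, Matrix.mul_zero, Matrix.zero_mul] at this
        exact this
      · exact (conjTranspose_mul_mul_mul V₂ V₂ (W₂ i) (W₂ k) (π s)).trans
          (hz₂ i k s fun h => hik (congrArg _ h))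
    · rintro (i | i)
      · have := hi₁ i
        simp only [← conjTranspose_mul_mul_mul] at this
        exact this
      · have := hi₂ i
        simp only [← conjTranspose_mul_mul_mul] at this
        exact this

/-- Schur's lemma: an intertwiner between irreducible families is zero or gives a unitary one. -/
lemma schur {σ m n : Type*} [Fintype m] [DecidableEq m] [Fintype n] [DecidableEq n] [Nonempty n]
    {a : σ → Matrix m m ℂ} {b : σ → Matrix n n ℂ} (ha : IsIrreducibleFamily a)
    (hb : IsIrreducibleFamily b) (hab : ∀ s, ∃ t, a t = (a s)ᴴ ∧ b t = (b s)ᴴ)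
    {Y : Matrix m n ℂ} (hY : ∀ s, a s * Y = Y * b s) (hY0 : Y ≠ 0) :
    ∃ w : Matrix m n ℂ, wᴴ * w = 1 ∧ w * wᴴ = 1 ∧ ∀ s, a s * w = w * b s := by
  have hY' : ∀ s, Yᴴ * a s = b s * Yᴴ := by
    intro s
    obtain ⟨t, hta, htb⟩ := hab s
    have := congrArg conjTranspose (hY t)
    simpa [conjTranspose_mul, hta, htb] using this
  -- `Yᴴ * Y` and `Y * Yᴴ` commute with irreducible families and are scalars; computing `Y * Yᴴ * Y`
  -- in two ways identifies the scalars, and `Y / √c` is unitary.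
  obtain ⟨c, hc⟩ := hb (Yᴴ * Y) fun s => by
    rw [Matrix.mul_assoc, ← hY, ← Matrix.mul_assoc, ← hY', Matrix.mul_assoc]
  obtain ⟨c', hc'⟩ := ha (Y * Yᴴ) fun s => by
    rw [Matrix.mul_assoc, hY', ← Matrix.mul_assoc, hY, Matrix.mul_assoc]
  have hc0 : c ≠ 0 := by
    rintro rfl
    rw [zero_smul, conjTranspose_mul_self_eq_zero] at hc
    exact hY0 hc
  have hcc : c = c' := by
    have h1 : c • Y = c' • Y := by
      calc c • Y = Y * (Yᴴ * Y) := by rw [hc]; simp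
        _ = c' • Y := by rw [← Matrix.mul_assoc, hc']; simp
    rw [← sub_eq_zero, ← sub_smul, smul_eq_zero] at h1
    exact sub_eq_zero.mp (h1.resolve_right hY0)
  subst hcc
  have hcpos : 0 ≤ c := by
    obtain ⟨x⟩ := ‹Nonempty n›
    have := (posSemidef_conjTranspose_mul_self Y).diag_nonneg (i := x)
    simpa [hc] using this
  have hcre : c = (c.re : ℂ) := Complex.eq_re_of_ofReal_le (r := 0) (by rwa [Complex.ofReal_zero])
  have hre : 0 ≤ c.re := (Complex.nonneg_iff.mp hcpos).1
  have hr : ((Real.sqrt c.re : ℝ) : ℂ) * (Real.sqrt c.re : ℝ) = c := by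
    rw [← Complex.ofReal_mul, Real.mul_self_sqrt hre, ← hcre]
  set r : ℂ := ((Real.sqrt c.re : ℝ) : ℂ)
  have hrs : star r = r := Complex.conj_ofReal _
  have hr0 : r ≠ 0 := by
    rintro h
    rw [h, mul_zero] at hr
    exact hc0 hr.symm
  refine ⟨r⁻¹ • Y, ?_, ?_, fun s => ?_⟩
  · rw [conjTranspose_smul, star_inv₀, hrs, Matrix.smul_mul, Matrix.mul_smul, hc, smul_smul,
      smul_smul, ← hr]
    field_simp
    simp
  · rw [conjTranspose_smul, star_inv₀, hrs, Matrix.smul_mul, Matrix.mul_smul, hc', smul_smul,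
      smul_smul, ← hr]
    field_simp
    simp
  · rw [Matrix.mul_smul, Matrix.smul_mul, hY]

/-- Decomposition into isotypic components, with unitarily identified irreducible summands. -/
lemma exists_isotypic_decomposition {σ n : Type*} [Fintype n] [DecidableEq n]
    (π : σ → Matrix n n ℂ) (hπ : IsStarClosed π) :
    ∃ (m : ℕ) (dJ dK : Fin m → ℕ) (V : ∀ j, Fin (dK j) → Matrix n (Fin (dJ j)) ℂ)
      (a : ∀ j, σ → Matrix (Fin (dJ j)) (Fin (dJ j)) ℂ),
      (∀ j, 0 < dJ j) ∧ (∀ j, 0 < dK j) ∧ (∀ j b, (V j b)ᴴ * V j b = 1) ∧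
      (∀ j b b', b ≠ b' → (V j b)ᴴ * V j b' = 0) ∧
      (∀ j j' b b', j ≠ j' → (V j b)ᴴ * V j' b' = 0) ∧
      ∑ j, ∑ b, V j b * (V j b)ᴴ = 1 ∧
      (∀ j b s, π s * V j b = V j b * a j s) ∧
      (∀ j b s, (V j b)ᴴ * π s = a j s * (V j b)ᴴ) ∧
      (∀ j, IsIrreducibleFamily (a j)) ∧
      ∀ j j', j ≠ j' → ∀ Y : Matrix (Fin (dJ j)) (Fin (dJ j')) ℂ,
        (∀ s, a j s * Y = Y * a j' s) → Y = 0 := by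
  classical
  obtain ⟨ι, _, d, V, hd, hV, ho, hs, hz, hi⟩ := exists_irreducible_decomposition π hπ
  let A : ∀ i, σ → Matrix (Fin (d i)) (Fin (d i)) ℂ := fun i s => (V i)ᴴ * π s * V i
  have hin : ∀ i s, π s * V i = V i * A i s := by
    intro i s
    calc π s * V i = (∑ k, V k * (V k)ᴴ) * (π s * V i) := by rw [hs, Matrix.one_mul]
      _ = ∑ k, V k * ((V k)ᴴ * π s * V i) := by
          simp only [Matrix.sum_mul, Matrix.mul_assoc]
      _ = _ := by
          rw [Finset.sum_eq_single i]
          · intro k _ hk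
            rw [hz k i s hk, Matrix.mul_zero]
          · simp
  have hin' : ∀ i s, (V i)ᴴ * π s = A i s * (V i)ᴴ := by
    intro i s
    calc (V i)ᴴ * π s = ((V i)ᴴ * π s) * (∑ k, V k * (V k)ᴴ) := by rw [hs, Matrix.mul_one]
      _ = ∑ k, ((V i)ᴴ * π s * V k) * (V k)ᴴ := by
          simp only [Matrix.mul_sum, Matrix.mul_assoc]
      _ = _ := by
          rw [Finset.sum_eq_single i]
          · intro k _ hk
            rw [hz i k s hk.symm, Matrix.zero_mul]
          · simp
  -- Unitary equivalence of irreducible summands; its classes become the blocks `j`.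
  let rel : Setoid ι :=
    { r := fun i k => ∃ w : Matrix (Fin (d i)) (Fin (d k)) ℂ,
        wᴴ * w = 1 ∧ w * wᴴ = 1 ∧ ∀ s, A i s * w = w * A k s
      iseqv :=
        { refl := fun i => ⟨1, by simp, by simp, by simp⟩
          symm := by
            rintro i k ⟨w, h1, h2, h3⟩
            refine ⟨wᴴ, by simpa using h2, by simpa using h1, fun s => ?_⟩
            calc A k s * wᴴ = wᴴ * (w * A k s) * wᴴ := by
                  rw [← Matrix.mul_assoc wᴴ, h1, Matrix.one_mul]
              _ = wᴴ * A i s * (w * wᴴ) := by rw [← h3]; simp only [Matrix.mul_assoc]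
              _ = _ := by rw [h2, Matrix.mul_one]
          trans := by
            rintro i k l ⟨w, h1, h2, h3⟩ ⟨w', h1', h2', h3'⟩
            refine ⟨w * w', ?_, ?_, fun s => ?_⟩
            · rw [conjTranspose_mul_mul, h1, Matrix.mul_one, h1']
            · rw [conjTranspose_mul, Matrix.mul_assoc, ← Matrix.mul_assoc w', h2',
                Matrix.one_mul, h2]
            · rw [← Matrix.mul_assoc, h3, Matrix.mul_assoc, h3', Matrix.mul_assoc] } }
  let e : Quotient rel ≃ Fin (Fintype.card (Quotient rel)) := Fintype.equivFin _
  let cl : ι → Fin (Fintype.card (Quotient rel)) := fun i => e (Quotient.mk rel i)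
  let rep : Fin (Fintype.card (Quotient rel)) → ι := fun j => (e.symm j).out
  have hcl : ∀ j, cl (rep j) = j := fun j => by simp [cl, rep]
  have hrel : ∀ i k, cl i = cl k → rel i k := fun i k h => Quotient.exact (e.injective h)
  have hrel' : ∀ i k, rel i k → cl i = cl k := fun i k h => congrArg e (Quotient.sound h)
  let f : ∀ j, Fin (Fintype.card {i // cl i = j}) ≃ {i // cl i = j} := fun j =>
    (Fintype.equivFin _).symm
  have hw : ∀ (j) (x : {i // cl i = j}), rel x.1 (rep j) := fun j x =>
    hrel _ _ (x.2.trans (hcl j).symm)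
  choose w hw1 hw2 hw3 using hw
  have hne : ∀ j j' b b', (f j b).1 = (f j' b').1 → j = j' := by
    intro j j' b b' h
    rw [← (f j b).2, ← (f j' b').2, h]
  -- Composing each inclusion with the unitary from the class representative makes the family act by
  -- literally the same matrices `A (rep j)` on all copies in a class.
  refine ⟨_, fun j => d (rep j), fun j => Fintype.card {i // cl i = j},
    fun j b => V (f j b).1 * w j (f j b), fun j => A (rep j), fun j => hd _, fun j => ?_,
    fun j b => ?_, fun j b b' hb => ?_, fun j j' b b' hj => ?_, ?_, fun j b s => ?_,
    fun j b s => ?_, fun j => hi _, fun j j' hj Y hY => ?_⟩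
  · exact Fintype.card_pos_iff.mpr ⟨⟨rep j, hcl j⟩⟩
  · rw [conjTranspose_mul_mul, hV, Matrix.mul_one, hw1]
  · rw [conjTranspose_mul_mul, ho, Matrix.mul_zero, Matrix.zero_mul]
    exact fun h => hb ((f j).injective (Subtype.ext h))
  · rw [conjTranspose_mul_mul, ho, Matrix.mul_zero, Matrix.zero_mul]
    exact fun h => hj (hne _ _ _ _ h)
  · have h1 : ∀ j b, V (f j b).1 * w j (f j b) * (V (f j b).1 * w j (f j b))ᴴ =
        V (f j b).1 * (V (f j b).1)ᴴ := by
      intro j b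
      rw [conjTranspose_mul, Matrix.mul_assoc, ← Matrix.mul_assoc (w j (f j b)), hw2,
        Matrix.one_mul]
    simp only [h1]
    rw [← hs]
    calc _ = ∑ j, ∑ x : {i // cl i = j}, V x.1 * (V x.1)ᴴ :=
          Finset.sum_congr rfl fun j _ =>
            (f j).sum_comp fun x : {i // cl i = j} => V x.1 * (V x.1)ᴴ
      _ = _ := by
          rw [← Fintype.sum_sigma']
          exact (Equiv.sigmaFiberEquiv cl).sum_comp fun i => V i * (V i)ᴴ
  · rw [← Matrix.mul_assoc, hin, Matrix.mul_assoc, hw3, Matrix.mul_assoc]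
  · have h1 : (w j (f j b))ᴴ * A (f j b).1 s = A (rep j) s * (w j (f j b))ᴴ := by
      calc _ = (w j (f j b))ᴴ * (A (f j b).1 s * w j (f j b)) * (w j (f j b))ᴴ := by
            rw [Matrix.mul_assoc, Matrix.mul_assoc (A _ _), hw2, Matrix.mul_one]
        _ = _ := by rw [hw3, ← Matrix.mul_assoc, hw1, Matrix.one_mul]
    rw [conjTranspose_mul, Matrix.mul_assoc, hin', ← Matrix.mul_assoc, h1, Matrix.mul_assoc]
  · by_contra hY0
    have : Nonempty (Fin (d (rep j'))) := ⟨⟨0, hd _⟩⟩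
    refine hj ?_
    rw [← hcl j, ← hcl j']
    refine hrel' _ _ (schur (hi _) (hi _) (fun s => ?_) hY hY0)
    obtain ⟨t, ht⟩ := hπ s
    refine ⟨t, ?_⟩
    constructor <;> simp [A, ht, conjTranspose_mul, Matrix.mul_assoc]

/-- A star-closed family acts on the factors `Jⱼ` and its commutant on the factors `Kⱼ` of a
decomposition `⨁ⱼ Jⱼ ⊗ Kⱼ`. -/
lemma exists_tensorDecomposition {σ n : Type*} [Fintype n] [DecidableEq n]
    (π : σ → Matrix n n ℂ) (hπ : IsStarClosed π) :
    ∃ D : TensorDecomposition n,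
      (∀ s, ∃ X : ∀ j, D.OpJ j, π s = D.directSum fun j => X j ⊗ₖ 1) ∧
      ∀ Y, (∀ s, π s * Y = Y * π s) →
        ∃ Z : ∀ j, D.OpK j, Y = D.directSum fun j => 1 ⊗ₖ Z j := by
  obtain ⟨m, dJ, dK, V, a, hdJ, hdK, hV, hV0, hV0', hsum, hint, hint', hirr, hschur⟩ :=
    exists_isotypic_decomposition π hπ
  -- The `Jⱼ` index runs through a basis of the irreducible space, the `Kⱼ` index through its
  -- copies.
  let W : Matrix n (Σ j, Fin (dJ j) × Fin (dK j)) ℂ := of fun x p => V p.1 p.2.2 x p.2.1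
  have hframe : ∀ (Y : Matrix n n ℂ) p q,
      (Wᴴ * Y * W) p q = ((V p.1 p.2.2)ᴴ * Y * V q.1 q.2.2) p.2.1 q.2.1 := by
    intro Y p q
    simp [W, Matrix.mul_apply]
  have hframe1 : ∀ p q, (Wᴴ * W) p q = ((V p.1 p.2.2)ᴴ * V q.1 q.2.2) p.2.1 q.2.1 := by
    intro p q
    simp [W, Matrix.mul_apply]
  have hW : Wᴴ * W = 1 := by
    ext ⟨j, c, b⟩ ⟨j', c', b'⟩
    rw [hframe1]
    by_cases hj : j = j'
    · subst hj
      by_cases hb : b = b'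
      · subst hb
        simp [hV, Matrix.one_apply]
      · simp [hV0 j b b' hb, hb]
    · simp [hV0' j j' b b' hj, hj]
  have hW' : W * Wᴴ = 1 := by
    rw [← hsum]
    ext x y
    simp only [W, Matrix.mul_apply, Matrix.sum_apply, Fintype.sum_sigma, Fintype.sum_prod_type,
      conjTranspose_apply, of_apply]
    exact Finset.sum_congr rfl fun j _ => Finset.sum_comm
  let D : TensorDecomposition n := ⟨m, dJ, dK, hdJ, hdK, W, hW, hW'⟩
  have hD : ∀ (Y : Matrix n n ℂ) (X : ∀ j, D.OpJK j), Wᴴ * Y * W = blockDiagonal' X →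
      Y = D.directSum X := by
    intro Y X h
    rw [TensorDecomposition.directSum, ← h]
    exact (D.conj_frame Y).symm
  refine ⟨D, fun s => ⟨fun j => a j s, hD _ _ ?_⟩, fun Y hY => ?_⟩
  · ext ⟨j, c, b⟩ ⟨j', c', b'⟩
    rw [hframe]
    by_cases hj : j = j'
    · subst hj
      rw [blockDiagonal'_apply_eq]
      simp only [hint', Matrix.mul_assoc, kroneckerMap_apply]
      by_cases hb : b = b'
      · subst hb
        simp [hV]
      · simp [hV0 j b b' hb, hb]
    · rw [blockDiagonal'_apply_ne _ _ _ hj]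
      simp [hint', Matrix.mul_assoc, hV0' j j' b b' hj]
  · have hYint : ∀ j j' b b' s, a j s * ((V j b)ᴴ * Y * V j' b') =
        ((V j b)ᴴ * Y * V j' b') * a j' s := by
      intro j j' b b' s
      calc _ = ((V j b)ᴴ * π s) * Y * V j' b' := by rw [hint']; simp only [Matrix.mul_assoc]
        _ = (V j b)ᴴ * (π s * Y) * V j' b' := by simp only [Matrix.mul_assoc]
        _ = (V j b)ᴴ * Y * (π s * V j' b') := by rw [hY]; simp only [Matrix.mul_assoc]
        _ = _ := by rw [hint]; simp only [Matrix.mul_assoc]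
    -- Each piece of `Y` between two copies is an intertwiner: scalar within a class, zero between
    -- classes. The scalars are the entries of the operator on `Kⱼ`.
    choose c hc using fun j b b' => hirr j _ (hYint j j b b')
    refine ⟨fun j => of (c j), hD _ _ ?_⟩
    ext ⟨j, x, b⟩ ⟨j', x', b'⟩
    rw [hframe]
    by_cases hj : j = j'
    · subst hj
      rw [blockDiagonal'_apply_eq]
      simp [hc, mul_comm]
    · rw [blockDiagonal'_apply_ne _ _ _ hj]
      simp [hschur j j' hj _ (hYint j j' b b')]

/-! ### Commutants and fixed points of the dual map. -/

/-- The commutant of the Kraus operators and their adjoints. -/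
def krausCommutant {ι n : Type*} [Fintype n] (M : ι → Matrix n n ℂ) :
    Submodule ℂ (Matrix n n ℂ) where
  carrier := {X | ∀ i, X * M i = M i * X ∧ X * (M i)ᴴ = (M i)ᴴ * X}
  add_mem' hX hY i := by
    simp only [Matrix.add_mul, Matrix.mul_add, (hX i).1, (hX i).2, (hY i).1, (hY i).2, and_self]
  zero_mem' i := by simp
  smul_mem' c X hX i := by simp [(hX i).1, (hX i).2]

lemma mem_krausCommutant {ι n : Type*} [Fintype n] {M : ι → Matrix n n ℂ} {X : Matrix n n ℂ} :
    X ∈ krausCommutant M ↔ ∀ i, X * M i = M i * X ∧ X * (M i)ᴴ = (M i)ᴴ * X := Iff.rfl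

lemma conjTranspose_mem_krausCommutant {ι n : Type*} [Fintype n] {M : ι → Matrix n n ℂ}
    {X : Matrix n n ℂ} (hX : X ∈ krausCommutant M) : Xᴴ ∈ krausCommutant M := by
  intro i
  have h1 := congrArg conjTranspose (hX i).1
  have h2 := congrArg conjTranspose (hX i).2
  simp only [conjTranspose_mul, conjTranspose_conjTranspose] at h1 h2
  exact ⟨h2.symm, h1.symm⟩

lemma sum_conjTranspose_mul_mul_of_mem_krausCommutant {ι n : Type*} [Fintype ι] [Fintype n]
    [DecidableEq n] {M : ι → Matrix n n ℂ} (hM : ∑ i, (M i)ᴴ * M i = 1) {X : Matrix n n ℂ}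
    (hX : X ∈ krausCommutant M) : ∑ i, (M i)ᴴ * X * M i = X := by
  calc _ = ∑ i, X * ((M i)ᴴ * M i) :=
        Finset.sum_congr rfl fun i _ => by rw [← (hX i).2, Matrix.mul_assoc]
    _ = X := by rw [← Finset.mul_sum, hM, Matrix.mul_one]

/-- Faithfulness of `R`: with `R = Bᴴ * B` the trace is the squared Hilbert–Schmidt norm of `B *
Cᴴ`, so `R * Cᴴ = 0`, and `R` is invertible. -/
lemma eq_zero_of_trace_mul_conjTranspose_mul_self {n : Type*} [Fintype n] [DecidableEq n]
    {R C : Matrix n n ℂ} (hR : R.PosDef) (h : (R * (Cᴴ * C)).trace = 0) : C = 0 := by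
  obtain ⟨B, rfl⟩ := PosSemidef.exists_eq_conjTranspose_mul_self hR.posSemidef
  have h1 : ((B * Cᴴ)ᴴ * (B * Cᴴ)).trace = 0 := by
    calc _ = (C * (Bᴴ * B * Cᴴ)).trace := by simp [conjTranspose_mul, Matrix.mul_assoc]
      _ = 0 := by rw [trace_mul_comm, ← h]; simp only [Matrix.mul_assoc]
  rw [trace_conjTranspose_mul_self_eq_zero_iff] at h1
  have h2 : Bᴴ * B * Cᴴ = (Bᴴ * B) * 0 := by rw [Matrix.mul_assoc, h1]; simp
  exact conjTranspose_eq_zero.mp (hR.isUnit.mul_left_cancel h2)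

/-- A fixed point of the dual of a quantum operation with faithful invariant state commutes with
the Kraus operators. -/
lemma commute_kraus_of_fixed {ι n : Type*} [Fintype ι] [Fintype n] [DecidableEq n]
    {M : ι → Matrix n n ℂ} (hM : ∑ i, (M i)ᴴ * M i = 1) {R : Matrix n n ℂ} (hR : R.PosDef)
    (hMR : krausMap M R = R) {X : Matrix n n ℂ} (hX : ∑ i, (M i)ᴴ * X * M i = X) (i : ι) :
    X * M i = M i * X := by
  have hX' : ∑ i, (M i)ᴴ * Xᴴ * M i = Xᴴ := by
    have := congrArg conjTranspose hX
    simpa [conjTranspose_sum, conjTranspose_mul, Matrix.mul_assoc] using this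
  -- This is the defect in the Kadison–Schwarz inequality. The invariant state `R` gives it
  -- expectation zero, so every commutator vanishes.
  have hdefect : ∑ i, (X * M i - M i * X)ᴴ * (X * M i - M i * X) =
      (∑ i, (M i)ᴴ * (Xᴴ * X) * M i) - Xᴴ * X := by
    have h1 : ∀ i, (X * M i - M i * X)ᴴ * (X * M i - M i * X) =
        (M i)ᴴ * (Xᴴ * X) * M i - ((M i)ᴴ * Xᴴ * M i) * X - Xᴴ * ((M i)ᴴ * X * M i)
          + Xᴴ * ((M i)ᴴ * M i) * X := by
      intro i
      rw [conjTranspose_sub, conjTranspose_mul, conjTranspose_mul]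
      noncomm_ring
    simp only [h1, Finset.sum_add_distrib, Finset.sum_sub_distrib, ← Finset.sum_mul,
      ← Finset.mul_sum, hX, hX', hM]
    noncomm_ring
  have htrace : ∑ i, (R * ((X * M i - M i * X)ᴴ * (X * M i - M i * X))).trace = 0 := by
    rw [← trace_sum, ← Finset.mul_sum, hdefect, Matrix.mul_sub, trace_sub,
      ← trace_krausMap_mul, hMR, sub_self]
  have hnonneg : ∀ i ∈ Finset.univ,
      0 ≤ (R * ((X * M i - M i * X)ᴴ * (X * M i - M i * X))).trace := by
    intro i _
    rw [← Matrix.mul_assoc, trace_mul_comm, ← Matrix.mul_assoc]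
    exact (hR.posSemidef.mul_mul_conjTranspose_same _).trace_nonneg
  have := (Finset.sum_eq_zero_iff_of_nonneg hnonneg).mp htrace i (Finset.mem_univ i)
  exact sub_eq_zero.mp (eq_zero_of_trace_mul_conjTranspose_mul_self hR this)

/-- The adjoint of a fixed point is again fixed; taking adjoints in its commutation relations gives
those of `X` with the adjoints of the Kraus operators. -/
lemma mem_krausCommutant_of_fixed {ι n : Type*} [Fintype ι] [Fintype n] [DecidableEq n]
    {M : ι → Matrix n n ℂ} (hM : ∑ i, (M i)ᴴ * M i = 1) {R : Matrix n n ℂ} (hR : R.PosDef)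
    (hMR : krausMap M R = R) {X : Matrix n n ℂ} (hX : ∑ i, (M i)ᴴ * X * M i = X) :
    X ∈ krausCommutant M := by
  intro i
  have hX' : ∑ i, (M i)ᴴ * Xᴴ * M i = Xᴴ := by
    have := congrArg conjTranspose hX
    simpa [conjTranspose_sum, conjTranspose_mul, Matrix.mul_assoc] using this
  refine ⟨commute_kraus_of_fixed hM hR hMR hX i, ?_⟩
  have := congrArg conjTranspose (commute_kraus_of_fixed hM hR hMR hX' i)
  simpa [conjTranspose_mul] using this.symm

lemma krausMap_mul {n ι ι' : Type*} [Fintype n] [Fintype ι] [Fintype ι'] (M : ι → Matrix n n ℂ)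
    (M' : ι' → Matrix n n ℂ) :
    krausMap (fun p : ι × ι' => M p.1 * M' p.2) = krausMap M * krausMap M' := by
  refine LinearMap.ext fun σ => ?_
  simp only [krausMap_apply, Fintype.sum_prod_type, Finset.mul_sum, Finset.sum_mul,
    conjTranspose_mul, Matrix.mul_assoc, Module.End.mul_apply]

lemma krausMap_average {n κ' ι : Type*} [Fintype n] [Fintype κ'] [Fintype ι] (c : ℂ)
    (F : κ' → ι → Matrix n n ℂ) :
    krausMap (fun p : κ' × ι => c • F p.1 p.2) = (c * star c) • ∑ k, krausMap (F k) := by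
  refine LinearMap.ext fun σ => ?_
  simp [krausMap_apply, Fintype.sum_prod_type, Finset.smul_sum, smul_smul, mul_comm]

/-! ### Invariant operations and the smallest commutant. -/

/-- Kraus operators of a quantum operation that fixes all `ρ k`. -/
structure IsInvariantKraus {κ ι n : Type*} [Fintype ι] [Fintype n] [DecidableEq n]
    (ρ : κ → Matrix n n ℂ) (M : ι → Matrix n n ℂ) : Prop where
  sum_eq_one : ∑ i, (M i)ᴴ * M i = 1
  map_eq : ∀ k, krausMap M (ρ k) = ρ k

section Invariant

variable {κ n : Type*} [Fintype n] [DecidableEq n] {ρ : κ → Matrix n n ℂ}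

lemma krausMap_eq_self_of_mem_span {ι : Type*} [Fintype ι] {M : ι → Matrix n n ℂ}
    (hM : IsInvariantKraus ρ M) {R : Matrix n n ℂ} (hR : R ∈ Submodule.span ℂ (Set.range ρ)) :
    krausMap M R = R := by
  have : Submodule.span ℂ (Set.range ρ) ≤ LinearMap.ker (krausMap M - LinearMap.id) := by
    rw [Submodule.span_le]
    rintro _ ⟨k, rfl⟩
    simp [hM.map_eq]
  simpa [sub_eq_zero] using this hR

/-- Products and averages enlarge the index set. Returning to the index type `n × n` keeps all
invariant operations in one space, where minimization and limits make sense. -/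
lemma IsInvariantKraus.exists_standard {ι : Type*} [Fintype ι] {M : ι → Matrix n n ℂ}
    (hM : IsInvariantKraus ρ M) :
    ∃ M' : n × n → Matrix n n ℂ, krausMap M' = krausMap M ∧ IsInvariantKraus ρ M' := by
  obtain ⟨M', h1, h2⟩ := (isQuantumOperation_krausMap hM.sum_eq_one).exists_krausMap
  exact ⟨M', h1.symm, h2, fun k => by rw [← h1]; exact hM.map_eq k⟩

lemma isInvariantKraus_one : IsInvariantKraus ρ (fun _ : Unit => (1 : Matrix n n ℂ)) :=
  ⟨by simp, fun k => by simp [krausMap_apply]⟩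

lemma IsInvariantKraus.mul {ι ι' : Type*} [Fintype ι] [Fintype ι'] {M : ι → Matrix n n ℂ}
    {M' : ι' → Matrix n n ℂ} (hM : IsInvariantKraus ρ M) (hM' : IsInvariantKraus ρ M') :
    IsInvariantKraus ρ (fun p : ι × ι' => M p.1 * M' p.2) := by
  refine ⟨sum_conjTranspose_mul_self_of_trace fun σ => ?_, fun k => ?_⟩
  · rw [krausMap_mul, Module.End.mul_apply,
      (isQuantumOperation_krausMap hM.sum_eq_one).trace_map,
      (isQuantumOperation_krausMap hM'.sum_eq_one).trace_map]
  · rw [krausMap_mul, Module.End.mul_apply, hM'.map_eq, hM.map_eq]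

lemma IsInvariantKraus.average {κ' ι : Type*} [Fintype κ'] [Fintype ι] {c : ℂ}
    (hc : c * star c * Fintype.card κ' = 1) {F : κ' → ι → Matrix n n ℂ}
    (hF : ∀ k, IsInvariantKraus ρ (F k)) :
    IsInvariantKraus ρ (fun p : κ' × ι => c • F p.1 p.2) := by
  refine ⟨sum_conjTranspose_mul_self_of_trace fun σ => ?_, fun k => ?_⟩
  · rw [krausMap_average]
    simp only [LinearMap.smul_apply, LinearMap.sum_apply, trace_smul, trace_sum,
      (isQuantumOperation_krausMap (hF _).sum_eq_one).trace_map]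
    simp only [Finset.sum_const, Finset.card_univ, ← Nat.cast_smul_eq_nsmul ℂ, smul_smul, hc,
      one_smul]
  · rw [krausMap_average]
    simp only [LinearMap.smul_apply, LinearMap.sum_apply, (hF _).map_eq]
    simp only [Finset.sum_const, Finset.card_univ, ← Nat.cast_smul_eq_nsmul ℂ, smul_smul, hc,
      one_smul]

lemma exists_mul_star_mul_card (κ' : Type*) [Fintype κ'] [Nonempty κ'] :
    ∃ c : ℂ, c * star c * Fintype.card κ' = 1 ∧ c * star c = (Fintype.card κ' : ℂ)⁻¹ := by
  have h0 : (Fintype.card κ' : ℂ) ≠ 0 := by simp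
  have h : ((√(Fintype.card κ' : ℝ)⁻¹ : ℝ) : ℂ) * star ((√(Fintype.card κ' : ℝ)⁻¹ : ℝ) : ℂ) =
      (Fintype.card κ' : ℂ)⁻¹ := by
    rw [Complex.star_def, Complex.conj_ofReal, ← Complex.ofReal_mul,
      Real.mul_self_sqrt (by positivity)]
    simp
  exact ⟨_, by rw [h, inv_mul_cancel₀ h0], h⟩

/-- There is an invariant Kraus family with smallest commutant. -/
lemma exists_krausCommutant_le {R : Matrix n n ℂ} (hR : R.PosDef)
    (hRρ : R ∈ Submodule.span ℂ (Set.range ρ)) :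
    ∃ M₀ : n × n → Matrix n n ℂ, IsInvariantKraus ρ M₀ ∧
      ∀ M : n × n → Matrix n n ℂ, IsInvariantKraus ρ M → krausCommutant M₀ ≤ krausCommutant M := by
  let s : Set (n × n → Matrix n n ℂ) := {M | IsInvariantKraus ρ M}
  have hs : s.Nonempty := by
    obtain ⟨M, -, hM⟩ := (isInvariantKraus_one (ρ := ρ)).exists_standard
    exact ⟨M, hM⟩
  let f : (n × n → Matrix n n ℂ) → ℕ := fun M => Module.finrank ℂ (krausCommutant M)
  obtain ⟨M₀, hM₀, hmin⟩ : ∃ M₀ ∈ s, ∀ M ∈ s, f M₀ ≤ f M :=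
    ⟨Function.argminOn f s hs, Function.argminOn_mem f s hs,
      fun M hM => Function.argminOn_le f s hM⟩
  refine ⟨M₀, hM₀, fun M hM => ?_⟩
  obtain ⟨c, hc, -⟩ := exists_mul_star_mul_card Bool
  let F : Bool → n × n → Matrix n n ℂ := fun b => if b then M₀ else M
  have hF : ∀ b, IsInvariantKraus ρ (F b) := by
    rintro (_ | _)
    exacts [hM, hM₀]
  have hF' := IsInvariantKraus.average hc hF
  have hc0 : c ≠ 0 := by
    rintro rfl
    simp at hc
  obtain ⟨M', hM'F, hM'⟩ := hF'.exists_standard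
  -- The commutant depends only on the map, being the fixed-point set of its dual; so passing from
  -- `M'` to the concatenated family is harmless, and that family contains both `M₀` and `M` up to
  -- the factor `c`.
  have hle : ∀ b, krausCommutant M' ≤ krausCommutant (F b) := by
    intro b X hX
    have h1 := sum_conjTranspose_mul_mul_of_mem_krausCommutant hM'.sum_eq_one hX
    have h2 : ∑ p : Bool × n × n, (c • F p.1 p.2)ᴴ * X * (c • F p.1 p.2) = X := by
      refine eq_of_forall_trace_mul_eq fun σ => ?_
      rw [← trace_krausMap_mul, ← hM'F, trace_krausMap_mul, h1]
    have h3 := mem_krausCommutant_of_fixed hF'.sum_eq_one hR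
      (krausMap_eq_self_of_mem_span hF' hRρ) h2
    intro i
    have h4 := h3 (b, i)
    simpa [conjTranspose_smul, hc0, smul_right_inj] using h4
  have heq : krausCommutant M' = krausCommutant M₀ :=
    Submodule.eq_of_le_of_finrank_le (hle true) (hmin M' hM')
  rw [← heq]
  exact hle false

end Invariant

/-! ### Compactness and Cesàro means. -/

lemma norm_apply_le_one_of_sum_conjTranspose_mul_self {ι n : Type*} [Fintype ι] [Fintype n]
    [DecidableEq n] {M : ι → Matrix n n ℂ} (hM : ∑ i, (M i)ᴴ * M i = 1) (i : ι) (a b : n) :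
    ‖M i a b‖ ≤ 1 := by
  have h1 : ∑ i, ∑ a, ‖M i a b‖ ^ 2 = 1 := by
    have := congrFun (congrFun hM b) b
    simp only [Matrix.sum_apply, Matrix.mul_apply, conjTranspose_apply, one_apply_eq] at this
    have h2 : ∀ z : ℂ, star z * z = ((‖z‖ ^ 2 : ℝ) : ℂ) := fun z => by
      rw [Complex.star_def, Complex.conj_mul']
      push_cast
      rfl
    simp only [h2] at this
    exact_mod_cast this
  have h3 : ‖M i a b‖ ^ 2 ≤ 1 := by
    rw [← h1]
    exact (Finset.single_le_sum (f := fun a => ‖M i a b‖ ^ 2) (fun _ _ => by positivity)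
      (Finset.mem_univ a)).trans (Finset.single_le_sum
        (f := fun i => ∑ a, ‖M i a b‖ ^ 2) (fun _ _ => by positivity) (Finset.mem_univ i))
  exact (sq_le_one_iff₀ (norm_nonneg _)).mp h3

lemma isCompact_setOf_sum_conjTranspose_mul_self_eq_one (ι n : Type*) [Fintype ι] [Fintype n]
    [DecidableEq n] : IsCompact {M : ι → Matrix n n ℂ | ∑ i, (M i)ᴴ * M i = 1} := by
  have hball : IsCompact (Set.pi Set.univ fun _ : ι =>
      (Set.pi Set.univ fun _ => Set.pi Set.univ fun _ => Metric.closedBall (0 : ℂ) 1 :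
        Set (n → n → ℂ))) :=
    isCompact_univ_pi fun _ => isCompact_univ_pi fun _ => isCompact_univ_pi fun _ =>
      isCompact_closedBall 0 1
  refine hball.of_isClosed_subset (isClosed_eq ?_ continuous_const) ?_
  · fun_prop
  · intro M hM i _ a _ b _
    rw [mem_closedBall_zero_iff]
    exact norm_apply_le_one_of_sum_conjTranspose_mul_self hM i a b

lemma continuous_krausMap_apply {ι n : Type*} [Fintype ι] [Fintype n] (σ : Matrix n n ℂ) :
    Continuous fun M : ι → Matrix n n ℂ => krausMap M σ := by
  simp only [krausMap_apply]
  fun_prop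

section Invariant

variable {κ n : Type*} [Fintype n] [DecidableEq n] {ρ : κ → Matrix n n ℂ}

lemma IsInvariantKraus.exists_pow {M₀ : n × n → Matrix n n ℂ} (hM₀ : IsInvariantKraus ρ M₀)
    (k : ℕ) : ∃ M : n × n → Matrix n n ℂ, krausMap M = krausMap M₀ ^ k ∧ IsInvariantKraus ρ M := by
  induction k with
  | zero =>
    obtain ⟨M, h1, h2⟩ := (isInvariantKraus_one (ρ := ρ)).exists_standard
    refine ⟨M, ?_, h2⟩
    rw [h1, pow_zero]
    exact LinearMap.ext fun σ => by simp [krausMap_apply]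
  | succ k ih =>
    obtain ⟨M, h1, h2⟩ := ih
    obtain ⟨M', h1', h2'⟩ := (h2.mul hM₀).exists_standard
    exact ⟨M', by rw [h1', krausMap_mul, h1, pow_succ], h2'⟩

open Filter Topology in
/-- A limit of the Cesàro means of a quantum operation absorbs it. -/
lemma IsInvariantKraus.exists_absorbing {M₀ : n × n → Matrix n n ℂ}
    (hM₀ : IsInvariantKraus ρ M₀) :
    ∃ P : n × n → Matrix n n ℂ, IsInvariantKraus ρ P ∧
      ∀ σ, krausMap P (krausMap M₀ σ) = krausMap P σ := by
  choose A hA hAinv using hM₀.exists_pow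
  have hmean : ∀ N : ℕ, ∃ C : n × n → Matrix n n ℂ, IsInvariantKraus ρ C ∧
      krausMap C = ((N + 1 : ℕ) : ℂ)⁻¹ • ∑ k ∈ Finset.range (N + 1), krausMap M₀ ^ k := by
    intro N
    obtain ⟨c, hc, hc'⟩ := exists_mul_star_mul_card (Fin (N + 1))
    obtain ⟨C, h1, h2⟩ := (IsInvariantKraus.average hc
      (F := fun k : Fin (N + 1) => A k) fun k => hAinv k).exists_standard
    refine ⟨C, h2, ?_⟩
    rw [h1, krausMap_average c fun k : Fin (N + 1) => A k, hc', Fintype.card_fin]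
    simp only [hA, Finset.sum_range]
  choose C hCinv hC using hmean
  have hK := isCompact_setOf_sum_conjTranspose_mul_self_eq_one (n × n) n
  -- A limit along a free ultrafilter replaces the choice of a convergent subsequence of the means.
  obtain ⟨P, hPK, hP⟩ := hK.ultrafilter_le_nhds ((hyperfilter ℕ).map C)
    (le_principal_iff.mpr (Ultrafilter.mem_map.mpr
      (Filter.univ_mem' fun N => (hCinv N).sum_eq_one)))
  have hlim : Tendsto C (hyperfilter ℕ) (𝓝 P) := hP
  have hlim' : ∀ σ, Tendsto (fun N => krausMap (C N) σ) (hyperfilter ℕ) (𝓝 (krausMap P σ)) :=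
    fun σ => (continuous_krausMap_apply σ).continuousAt.tendsto.comp hlim
  refine ⟨P, ⟨hPK, fun k => ?_⟩, fun σ => ?_⟩
  · refine tendsto_nhds_unique (hlim' (ρ k)) ?_
    simp only [(hCinv _).map_eq]
    exact tendsto_const_nhds
  · ext a b
    have hcont : Continuous fun M : Matrix n n ℂ => M a b := by fun_prop
    have h1 := (hcont.tendsto _).comp (hlim' (krausMap M₀ σ))
    have h2 := (hcont.tendsto _).comp (hlim' σ)
    have h3 : Tendsto (fun N : ℕ => ((N + 1 : ℕ) : ℂ)⁻¹ *
        ((krausMap M₀ ^ (N + 1)) σ a b - σ a b)) atTop (𝓝 0) := by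
      -- All powers of the operation have Kraus families in the compact set, so their entries at `σ`
      -- are uniformly bounded; the telescoped difference of the means is then `O(1/N)`.
      obtain ⟨B, hB⟩ := hK.exists_bound_of_continuousOn
        (hcont.comp (continuous_krausMap_apply σ)).continuousOn
      have hbd : ∀ N : ℕ, ‖((N + 1 : ℕ) : ℂ)⁻¹ * ((krausMap M₀ ^ (N + 1)) σ a b - σ a b)‖ ≤
          ((N : ℝ) + 1)⁻¹ * (B + ‖σ a b‖) := by
        intro N
        have h4 := hB (A (N + 1)) (hAinv (N + 1)).sum_eq_one
        simp only [Function.comp_apply, hA] at h4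
        rw [norm_mul, norm_inv, Complex.norm_natCast]
        push_cast
        gcongr
        exact (norm_sub_le _ _).trans (by gcongr)
      refine squeeze_zero_norm hbd ?_
      have h5 : Tendsto (fun N : ℕ => ((N : ℝ) + 1)⁻¹) atTop (𝓝 0) := by
        simpa using tendsto_one_div_add_atTop_nhds_zero_nat (𝕜 := ℝ)
      simpa using h5.mul_const (B + ‖σ a b‖)
    have h6 : ∀ N : ℕ, krausMap (C N) (krausMap M₀ σ) a b - krausMap (C N) σ a b =
        ((N + 1 : ℕ) : ℂ)⁻¹ * ((krausMap M₀ ^ (N + 1)) σ a b - σ a b) := by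
      intro N
      have h7 := congrArg (fun T => T σ a b) (geom_sum_mul (krausMap M₀) (N + 1))
      simp only [Module.End.mul_apply, LinearMap.sub_apply, Module.End.one_apply, map_sub,
        Matrix.sub_apply] at h7
      rw [hC, ← h7]
      simp only [LinearMap.smul_apply, Matrix.smul_apply, smul_eq_mul, mul_sub]
    have h8 := (h1.sub h2).congr h6
    exact sub_eq_zero.mp (tendsto_nhds_unique h8 (h3.mono_left Nat.hyperfilter_le_atTop))

/-- The fixed-point algebra of the duals of all invariant quantum operations, with an invariant
quantum operation whose dual maps into it. -/
lemma exists_conditional_expectation {R : Matrix n n ℂ} (hR : R.PosDef)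
    (hRρ : R ∈ Submodule.span ℂ (Set.range ρ)) :
    ∃ s : Set (Matrix n n ℂ), (∀ X ∈ s, Xᴴ ∈ s) ∧
      (∀ M : n × n → Matrix n n ℂ, IsInvariantKraus ρ M → ∀ i, ∀ X ∈ s, X * M i = M i * X) ∧
      ∃ P : n × n → Matrix n n ℂ, IsInvariantKraus ρ P ∧ ∀ X, ∑ i, (P i)ᴴ * X * P i ∈ s := by
  obtain ⟨M₀, hM₀, hmin⟩ := exists_krausCommutant_le hR hRρ
  obtain ⟨P, hP, habs⟩ := hM₀.exists_absorbing
  refine ⟨krausCommutant M₀, fun X hX => conjTranspose_mem_krausCommutant hX,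
    fun M hM i X hX => (hmin M hM hX i).1, P, hP, fun X => ?_⟩
  -- Dualizing the absorption `P T₀ = P` shows that the image of the dual of `P` is fixed by the
  -- dual of `T₀`.
  refine mem_krausCommutant_of_fixed hM₀.sum_eq_one hR (krausMap_eq_self_of_mem_span hM₀ hRρ) ?_
  refine eq_of_forall_trace_mul_eq fun σ => ?_
  rw [← trace_krausMap_mul, ← trace_krausMap_mul, habs, trace_krausMap_mul]

end Invariant

/-! ### Structure of the invariant states. -/

lemma isDensity_single {n : Type*} [Fintype n] [DecidableEq n] (a : n) :
    IsDensity (Matrix.single a a (1 : ℂ)) := by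
  refine ⟨?_, by simp⟩
  rw [← diagonal_single, posSemidef_diagonal_iff]
  intro i
  by_cases hi : i = a
  · subst hi
    simp
  · simp [hi]

lemma posSemidef_krausMap {ι n : Type*} [Fintype ι] [Fintype n] (M : ι → Matrix n n ℂ)
    {σ : Matrix n n ℂ} (hσ : σ.PosSemidef) : (krausMap M σ).PosSemidef :=
  posSemidef_sum _ fun i _ => hσ.mul_mul_conjTranspose_same (M i)

lemma exists_density_eq_smul {n : Type*} [Fintype n] [DecidableEq n] [Nonempty n]
    {Q : Matrix n n ℂ} (hQ : Q.PosSemidef) :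
    ∃ r : Matrix n n ℂ, IsDensity r ∧ Q = ((Q.trace.re : ℝ) : ℂ) • r := by
  have htr : ((Q.trace.re : ℝ) : ℂ) = Q.trace :=
    (Complex.eq_re_of_ofReal_le (r := 0) (by simpa using hQ.trace_nonneg)).symm
  rw [htr]
  by_cases h : Q.trace = 0
  -- A block of weight zero still needs some state; any one will do.
  · obtain ⟨a⟩ := ‹Nonempty n›
    exact ⟨Matrix.single a a 1, isDensity_single a, by simp [hQ.trace_eq_zero_iff.mp h]⟩
  · refine ⟨Q.trace⁻¹ • Q, ⟨hQ.smul (inv_nonneg.mpr hQ.trace_nonneg), ?_⟩, ?_⟩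
    · rw [trace_smul, smul_eq_mul, inv_mul_cancel₀ h]
    · rw [smul_smul, mul_inv_cancel₀ h, one_smul]

namespace TensorDecomposition

variable {n : Type*} [Fintype n] [DecidableEq n] (D : TensorDecomposition n)

lemma krausMap_directSum {ι : Type*} [Fintype ι] (N : ι → ∀ j, D.OpK j) (A : ∀ j, D.OpJ j)
    (B : ∀ j, D.OpK j) :
    krausMap (fun i => D.directSum fun j => 1 ⊗ₖ N i j) (D.directSum fun j => A j ⊗ₖ B j) =
      D.directSum fun j => A j ⊗ₖ krausMap (fun i => N i j) (B j) := by
  simp only [krausMap_apply, directSum_mul, directSum_conjTranspose, directSum_sum,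
    conjTranspose_kronecker, ← mul_kronecker_mul, sum_kronecker_right]
  simp

lemma blockDiagonal'_one_kronecker_mul_apply {κ : Type*} (N : ∀ j, D.OpK j)
    (R : Matrix D.Idx κ ℂ) (j : Fin D.m) (a : Fin (D.dJ j)) (b : Fin (D.dK j)) (q : κ) :
    ((blockDiagonal' fun j => (1 : D.OpJ j) ⊗ₖ N j) * R) ⟨j, a, b⟩ q =
      ∑ c, N j b c * R ⟨j, a, c⟩ q := by
  rw [Matrix.mul_apply, Fintype.sum_sigma, Finset.sum_eq_single j]
  · simp [blockDiagonal'_apply_eq, Fintype.sum_prod_type, Matrix.one_apply]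
  · intro k _ hk
    refine Finset.sum_eq_zero fun p _ => ?_
    rw [blockDiagonal'_apply_ne _ _ _ hk.symm, zero_mul]
  · simp

lemma mul_blockDiagonal'_one_kronecker_apply {κ : Type*} (N : ∀ j, D.OpK j)
    (R : Matrix κ D.Idx ℂ) (j : Fin D.m) (a : Fin (D.dJ j)) (b : Fin (D.dK j)) (q : κ) :
    (R * (blockDiagonal' fun j => (1 : D.OpJ j) ⊗ₖ N j)) q ⟨j, a, b⟩ =
      ∑ c, R q ⟨j, a, c⟩ * N j c b := by
  rw [Matrix.mul_apply, Fintype.sum_sigma, Finset.sum_eq_single j]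
  · rw [Fintype.sum_prod_type, Finset.sum_eq_single a]
    · simp [blockDiagonal'_apply_eq]
    · intro c _ hc
      simp [blockDiagonal'_apply_eq, hc]
    · simp
  · intro k _ hk
    refine Finset.sum_eq_zero fun p _ => ?_
    rw [blockDiagonal'_apply_ne _ _ _ hk, mul_zero]
  · simp

/-- If the dual of `∑ᵢ (⨁ⱼ 1 ⊗ N i j) · (⨁ⱼ 1 ⊗ N i j)*` maps into `⨁ⱼ B(Jⱼ) ⊗ 1`, then the blocks
of the Kraus operators are orthogonal. -/
lemma sum_kraus_entries {ι : Type*} [Fintype ι] {N : ι → ∀ j, D.OpK j}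
    (h : ∀ X, ∃ Y : ∀ j, D.OpJ j, ∑ i, (D.directSum fun j => 1 ⊗ₖ N i j)ᴴ * X *
      (D.directSum fun j => 1 ⊗ₖ N i j) = D.directSum fun j => Y j ⊗ₖ 1) :
    (∀ j j' b b' c c', j ≠ j' → ∑ i, N i j b c * star (N i j' b' c') = 0) ∧
    ∀ j b b' c c', ∑ i, N i j b c * star (N i j b' c') =
      if c = c' then ∑ i, N i j b 0 * star (N i j b' 0) else 0 := by
  have key : ∀ j j' b b', ∃ Y : ∀ j, D.OpJ j, ∀ c c',
      star (∑ i, N i j b c * star (N i j' b' c')) =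
        blockDiagonal' (fun j => Y j ⊗ₖ (1 : D.OpK j)) ⟨j, 0, c⟩ ⟨j', 0, c'⟩ := by
    intro j j' b b'
    -- On this matrix unit the dual map has the conjugated sums as entries. The form `Y ⊗ 1` of the
    -- result makes them vanish for `j ≠ j'` or `c ≠ c'`, and makes them independent of `c` when `c
    -- = c'`.
    let E : Matrix D.Idx D.Idx ℂ := Matrix.single ⟨j, 0, b⟩ ⟨j', 0, b'⟩ 1
    obtain ⟨Y, hY⟩ := h (D.W * E * D.Wᴴ)
    refine ⟨Y, fun c c' => ?_⟩
    have h1 := congrArg (fun Z => (D.Wᴴ * Z * D.W) ⟨j, 0, c⟩ ⟨j', 0, c'⟩) hY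
    simp only [frame_directSum] at h1
    rw [← h1]
    simp only [directSum_conjTranspose, conjTranspose_kronecker, conjTranspose_one]
    simp only [directSum, conj_mul_conj, ← Matrix.mul_sum, ← Matrix.sum_mul, frame_conj]
    rw [Matrix.sum_apply, star_sum]
    refine Finset.sum_congr rfl fun i _ => ?_
    rw [mul_blockDiagonal'_one_kronecker_apply]
    simp only [blockDiagonal'_one_kronecker_mul_apply]
    rw [Finset.sum_eq_single b', Finset.sum_eq_single b]
    · simp [E, mul_comm]
    · intro d _ hd
      simp [E, hd.symm]
    · simp
    · intro d _ hd
      rw [Finset.sum_eq_zero, zero_mul]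
      intro d' _
      simp [E, hd.symm]
    · simp
  refine ⟨fun j j' b b' c c' hj => ?_, fun j b b' c c' => ?_⟩
  · obtain ⟨Y, hY⟩ := key j j' b b'
    have := hY c c'
    rw [blockDiagonal'_apply_ne _ _ _ hj] at this
    exact star_eq_zero.mp this
  · obtain ⟨Y, hY⟩ := key j j b b'
    have h1 := hY c c'
    have h0 := hY 0 0
    rw [blockDiagonal'_apply_eq] at h1 h0
    split_ifs with hc
    · subst hc
      apply star_injective
      rw [h1, h0]
      simp
    · refine star_eq_zero.mp (h1.trans ?_)
      simp [hc]

/-- Invariant states of such a quantum operation have the form `⨁ⱼ Qⱼ ⊗ ωⱼ`. -/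
lemma eq_directSum_of_krausMap_eq {ι : Type*} [Fintype ι] {N : ι → ∀ j, D.OpK j}
    (h : ∀ X, ∃ Y : ∀ j, D.OpJ j, ∑ i, (D.directSum fun j => 1 ⊗ₖ N i j)ᴴ * X *
      (D.directSum fun j => 1 ⊗ₖ N i j) = D.directSum fun j => Y j ⊗ₖ 1)
    {ρ : Matrix n n ℂ} (hρ : krausMap (fun i => D.directSum fun j => 1 ⊗ₖ N i j) ρ = ρ) :
    ρ = D.directSum fun j =>
      (∑ c, (D.Wᴴ * ρ * D.W).submatrix (fun a => ⟨j, a, c⟩) (fun a => ⟨j, a, c⟩)) ⊗ₖ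
        krausMap (fun i => N i j) (Matrix.single 0 0 1) := by
  obtain ⟨hoff, hdiag⟩ := D.sum_kraus_entries h
  have hdiag' : ∀ j b b' c c', ∑ i, N i j b c * star (N i j b' c') =
      if c = c' then krausMap (fun i => N i j) (Matrix.single 0 0 1) b b' else 0 := by
    intro j b b' c c'
    rw [hdiag, krausMap_apply, Matrix.sum_apply]
    congr 1
    refine Finset.sum_congr rfl fun i _ => ?_
    simp [Matrix.mul_apply, Matrix.single_apply, ite_and]
  set R := D.Wᴴ * ρ * D.W with hR
  have hfix : ∑ i, (blockDiagonal' fun j => (1 : D.OpJ j) ⊗ₖ N i j) * R *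
      (blockDiagonal' fun j => (1 : D.OpJ j) ⊗ₖ (N i j)ᴴ) = R := by
    have h1 : D.Wᴴ * krausMap (fun i => D.directSum fun j => 1 ⊗ₖ N i j)
        (D.W * R * D.Wᴴ) * D.W = R := by
      rw [hR, conj_frame, hρ]
    simp only [krausMap_apply, directSum_conjTranspose, conjTranspose_kronecker,
      conjTranspose_one] at h1
    simpa only [directSum, conj_mul_conj, ← Matrix.mul_sum, ← Matrix.sum_mul, frame_conj] using h1
  -- The fixed-point equation in entries. Orthogonality of the Kraus blocks leaves only `j = j'` and
  -- `c = c'`, that is, the partial trace over `Kⱼ` times an entry of `ωⱼ`.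
  have hentry : ∀ j j' a a' b b', R ⟨j, a, b⟩ ⟨j', a', b'⟩ =
      ∑ c', ∑ c, R ⟨j, a, c⟩ ⟨j', a', c'⟩ * ∑ i, N i j b c * star (N i j' b' c') := by
    intro j j' a a' b b'
    conv_lhs => rw [← hfix]
    rw [Matrix.sum_apply]
    simp only [mul_blockDiagonal'_one_kronecker_apply, blockDiagonal'_one_kronecker_mul_apply]
    rw [Finset.sum_comm]
    refine Finset.sum_congr rfl fun c' _ => ?_
    simp only [Finset.sum_mul, Finset.mul_sum]
    rw [Finset.sum_comm]
    refine Finset.sum_congr rfl fun c _ => Finset.sum_congr rfl fun i _ => ?_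
    rw [conjTranspose_apply]
    ring
  rw [directSum, ← D.conj_frame ρ]
  congr 2
  ext ⟨j, a, b⟩ ⟨j', a', b'⟩
  rw [← hR, hentry]
  by_cases hj : j = j'
  · subst hj
    rw [blockDiagonal'_apply_eq]
    simp only [hdiag', mul_ite, mul_zero, Finset.sum_ite_eq', Finset.mem_univ, if_true,
      kroneckerMap_apply, Matrix.sum_apply, submatrix_apply, Finset.sum_mul]
  · rw [blockDiagonal'_apply_ne _ _ _ hj]
    simp only [hoff _ _ _ _ _ _ hj, mul_zero, Finset.sum_const_zero]

lemma posSemidef_frame {ρ : Matrix n n ℂ} (hρ : ρ.PosSemidef) : (D.Wᴴ * ρ * D.W).PosSemidef :=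
  hρ.conjTranspose_mul_mul_same D.W

/-- A state of the form `⨁ⱼ Qⱼ ⊗ ωⱼ` decomposes. -/
lemma decomposes_of_eq_directSum {ω : ∀ j, D.OpK j} {ρ : Matrix n n ℂ} (hρ : IsDensity ρ)
    (h : ρ = D.directSum fun j =>
      (∑ c, (D.Wᴴ * ρ * D.W).submatrix (fun a => ⟨j, a, c⟩) (fun a => ⟨j, a, c⟩)) ⊗ₖ ω j) :
    D.Decomposes ω ρ := by
  let Q : ∀ j, D.OpJ j := fun j =>
    ∑ c, (D.Wᴴ * ρ * D.W).submatrix (fun a => ⟨j, a, c⟩) (fun a => ⟨j, a, c⟩)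
  have hQ : ∀ j, (Q j).PosSemidef := fun j =>
    posSemidef_sum _ fun c _ => (D.posSemidef_frame hρ.posSemidef).submatrix _
  have htr : ∑ j, (Q j).trace = 1 := by
    calc ∑ j, (Q j).trace = (D.Wᴴ * ρ * D.W).trace := by
          simp only [Q, Matrix.trace, diag_apply, Matrix.sum_apply, submatrix_apply,
            Fintype.sum_sigma, Fintype.sum_prod_type]
      _ = 1 := by
          rw [trace_mul_comm, ← Matrix.mul_assoc, D.mul_conjTranspose_self, Matrix.one_mul,
            hρ.trace_eq_one]
  choose r hr hQr using fun j => exists_density_eq_smul (hQ j)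
  refine ⟨fun j => (Q j).trace.re, r, fun j => (Complex.nonneg_iff.mp (hQ j).trace_nonneg).1, ?_,
    hr, ?_⟩
  · rw [← Complex.re_sum, htr, Complex.one_re]
  · refine h.trans (congrArg _ (funext fun j => ?_))
    rw [← smul_kronecker, ← hQr j]

end TensorDecomposition

/-! ### Assembly of the theorem. -/

/-- The existence part of the Koashi–Imoto theorem. -/
lemma exists_tensorDecomposition_of_states {n : Type*} [Fintype n] [DecidableEq n] {K : ℕ}
    (ρ : Fin K → Matrix n n ℂ) (hρ : ∀ k, IsDensity (ρ k))
    (hsupp : ((K : ℂ)⁻¹ • ∑ k, ρ k).PosDef) :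
    ∃ (D : TensorDecomposition n) (ω : ∀ j, D.OpK j),
      (∀ j, IsDensity (ω j)) ∧ (∀ k, D.Decomposes ω (ρ k)) ∧
      ∀ T : Matrix n n ℂ →ₗ[ℂ] Matrix n n ℂ, IsQuantumOperation T → (∀ k, T (ρ k) = ρ k) →
        D.ActsBlockwise ω T := by
  obtain ⟨s, hs, hcomm, P, hP, hPs⟩ := exists_conditional_expectation (ρ := ρ) hsupp
    (Submodule.smul_mem _ _ (Submodule.sum_mem _ fun k _ => Submodule.subset_span ⟨k, rfl⟩))
  obtain ⟨D, hDs, hDc⟩ := exists_tensorDecomposition (Subtype.val : s → Matrix n n ℂ)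
    fun X => ⟨⟨_, hs X X.2⟩, rfl⟩
  have hkraus : ∀ M : n × n → Matrix n n ℂ, IsInvariantKraus ρ M →
      ∃ N : n × n → ∀ j, D.OpK j, M = fun i => D.directSum fun j => 1 ⊗ₖ N i j := by
    intro M hM
    choose N hN using fun i => hDc (M i) fun X => hcomm M hM i X X.2
    exact ⟨N, funext hN⟩
  obtain ⟨N, rfl⟩ := hkraus P hP
  let ω : ∀ j, D.OpK j := fun j => krausMap (fun i => N i j) (Matrix.single 0 0 1)
  have hρω := fun k => D.eq_directSum_of_krausMap_eq (fun X => hDs ⟨_, hPs X⟩) (hP.map_eq k)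
  refine ⟨D, ω, fun j => ⟨posSemidef_krausMap _ (isDensity_single 0).posSemidef, ?_⟩,
    fun k => D.decomposes_of_eq_directSum (hρ k) (hρω k), fun T hT hTρ => ?_⟩
  · rw [(isQuantumOperation_krausMap
      (D.sum_conjTranspose_mul_self_of_directSum hP.sum_eq_one j)).trace_map]
    exact (isDensity_single 0).trace_eq_one
  · obtain ⟨M, rfl, hM⟩ := hT.exists_krausMap
    obtain ⟨N', rfl⟩ := hkraus M ⟨hM, hTρ⟩
    refine D.actsBlockwise_of_kraus hM fun j => ?_
    let Q : Fin K → ∀ j, D.OpJ j := fun k j =>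
      ∑ c, (D.Wᴴ * ρ k * D.W).submatrix (fun a => ⟨j, a, c⟩) (fun a => ⟨j, a, c⟩)
    have hQ : ∀ k, ρ k = D.directSum fun j => Q k j ⊗ₖ ω j := hρω
    -- Full support of the average is needed here: a block missed by all `ρ k` would give it a zero
    -- diagonal entry. With `Q k j ≠ 0`, comparing `Q k j ⊗ S (ωⱼ)` with `Q k j ⊗ ωⱼ`, where `S` is
    -- the induced map on `Kⱼ`, yields `S (ωⱼ) = ωⱼ`.
    obtain ⟨k, hk⟩ : ∃ k, Q k j ≠ 0 := by
      by_contra! hcon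
      have hpos : (D.Wᴴ * ((K : ℂ)⁻¹ • ∑ k, ρ k) * D.W).PosDef := by
        refine hsupp.conjTranspose_mul_mul_same (B := D.W) fun x y hxy => ?_
        have := congrArg (D.Wᴴ *ᵥ ·) hxy
        simpa [mulVec_mulVec, D.conjTranspose_mul_self] using this
      have h0 : (D.Wᴴ * ((K : ℂ)⁻¹ • ∑ k, ρ k) * D.W) ⟨j, 0, 0⟩ ⟨j, 0, 0⟩ = 0 := by
        simp only [Matrix.mul_smul, Matrix.smul_mul, Matrix.mul_sum, Matrix.sum_mul,
          Matrix.smul_apply, Matrix.sum_apply]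
        rw [Finset.sum_eq_zero, smul_zero]
        intro k _
        rw [hQ k, D.frame_directSum, blockDiagonal'_apply_eq, hcon k]
        simp
      exact (hpos.diag_pos (i := ⟨j, 0, 0⟩)).ne' h0
    have h1 := hTρ k
    rw [hQ k, D.krausMap_directSum] at h1
    have h2 := congrFun (D.directSum_injective h1) j
    obtain ⟨a, a', ha⟩ : ∃ a a', Q k j a a' ≠ 0 := by
      by_contra! hcon
      exact hk (Matrix.ext hcon)
    ext b b'
    have h3 := congrFun (congrFun h2 (a, b)) (a', b')
    exact mul_left_cancel₀ ha h3

theorem mainTheorem2 {n : Type*} [Fintype n] [DecidableEq n] {K : ℕ}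
    (ρ : Fin K → Matrix n n ℂ) (hρ : ∀ k, IsDensity (ρ k))
    (hsupp : ((K : ℂ)⁻¹ • ∑ k, ρ k).PosDef) :
    (∃ (D : TensorDecomposition n) (ω : ∀ j, D.OpK j),
      (∀ j, IsDensity (ω j)) ∧
      (∀ k, D.Decomposes ω (ρ k)) ∧
      (∀ T : Matrix n n ℂ →ₗ[ℂ] Matrix n n ℂ, IsQuantumOperation T → (∀ k, T (ρ k) = ρ k) →
        D.ActsBlockwise ω T ∧
        ∀ (e : Type) [Fintype e] [DecidableEq e] (ε : Matrix e e ℂ)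
          (U : Matrix (n × e) (n × e) ℂ), IsStinespring T ε U → D.HasBlockForm ω ε U)) ∧
    (∀ (D : TensorDecomposition n) (ω : ∀ j, D.OpK j),
      (∀ j, IsDensity (ω j)) → (∀ k, D.Decomposes ω (ρ k)) →
      ∀ T : Matrix n n ℂ →ₗ[ℂ] Matrix n n ℂ, IsQuantumOperation T → (∀ k, T (ρ k) = ρ k) →
        (D.ActsBlockwise ω T ↔
          ∀ (e : Type) [Fintype e] [DecidableEq e] (ε : Matrix e e ℂ)
            (U : Matrix (n × e) (n × e) ℂ), IsStinespring T ε U → D.HasBlockForm ω ε U)) := by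
  refine ⟨?_, fun D ω _ _ T hT _ => ⟨fun h e _ _ ε U hU => D.hasBlockForm_of_actsBlockwise h hU,
    D.actsBlockwise_of_hasBlockForm hT⟩⟩
  obtain ⟨D, ω, hω, hdec, hacts⟩ := exists_tensorDecomposition_of_states ρ hρ hsupp
  exact ⟨D, ω, hω, hdec, fun T hT hTρ => ⟨hacts T hT hTρ, fun e _ _ ε U hU =>
    D.hasBlockForm_of_actsBlockwise (hacts T hT hTρ) hU⟩⟩
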